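/- Let $n\ge 3$ be an integer. A pentagulation of an $n$-gon is a finite simple connected graph drawn in the plane without crossings, one of whose faces is bounded by a cycle of length $n$ while all other faces are bounded by cycles of length five; these other faces are its pentagons (the unbounded face counts as a face). A graph $G$ is $3$-connected if it has more than three vertices and remains connected after the removal of any at most two vertices. Let $\operatorname{Pg}(n)$ be the smallest number of pentagons in a $3$-connected pentagulation of an $n$-gon. Theorem. If $n\ge 13$ is an integer and $n=5k+3l$ with integers $k$ and $l$ such that $0\le l\le 4$, then a $3$-connected pentagulation of an $n$-gon exists, and $$\operatorname{Pg}(n)\le 2n+k+l.$$ -/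

import Mathlib

/-- `G` is `k`-connected: it has more than `k` vertices, and removing fewer than `k` vertices always
leaves a connected graph. -/
def IsKConnected {V : Type} [Finite V] (G : SimpleGraph V) (k : ℕ) : Prop :=
  k < Nat.card V ∧ ∀ S : Set V, S.ncard < k → (G.induce Sᶜ).Connected

/-- A drawing without crossings of the graph `G` in the plane, which is identified with `ℂ`:
vertices are distinct points, every edge is a simple arc joining its two ends, and an arc meets
the vertices and the other arcs only in its own ends. The values of `arc` at pairs that are not
edges play no role. -/
structure PlaneDrawing {V : Type} (G : SimpleGraph V) where
  point : V → ℂ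
  arc : Sym2 V → Set ℂ
  point_injective : Function.Injective point
  arc_spec : ∀ ⦃u v : V⦄, G.Adj u v → ∃ γ : unitInterval → ℂ,
    Continuous γ ∧ Function.Injective γ ∧ γ 0 = point u ∧ γ 1 = point v ∧
      arc s(u, v) = Set.range γ
  mem_of_point_mem_arc : ∀ e ∈ G.edgeSet, ∀ v : V, point v ∈ arc e → v ∈ e
  arc_inter_arc : ∀ e ∈ G.edgeSet, ∀ f ∈ G.edgeSet, e ≠ f →
    ∀ z ∈ arc e ∩ arc f, ∃ v : V, v ∈ e ∧ v ∈ f ∧ z = point v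

namespace PlaneDrawing

variable {V : Type} {G : SimpleGraph V}

/-- The set of all points of the plane covered by the drawing. -/
def support (D : PlaneDrawing G) : Set ℂ :=
  Set.range D.point ∪ ⋃ e ∈ G.edgeSet, D.arc e

/-- The faces of the drawing: the connected components of the complement of the drawing. The
unbounded one is included. -/
def faces (D : PlaneDrawing G) : Set (Set ℂ) :=
  {F | ∃ z ∈ D.supportᶜ, F = connectedComponentIn D.supportᶜ z}

/-- The set `F` (a face) is bounded by a cycle of length `m` of the graph: its topological boundary
is the closed curve formed by the arcs of this cycle. -/
def IsPolygonalFace (D : PlaneDrawing G) (m : ℕ) (F : Set ℂ) : Prop :=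
  ∃ (v : V) (c : G.Walk v v), c.IsCycle ∧ c.length = m ∧
    frontier F = ⋃ e ∈ {e | e ∈ c.edges}, D.arc e

/-- The drawn graph is a pentagulation of an `n`-gon with `p` pentagons: it is connected, one face
is bounded by a cycle of length `n`, and the other faces, `p` in number, are bounded by cycles of
length five. (The face bounded by the `n`-cycle is not counted, even if `n = 5`.) -/
def IsPentagulation (D : PlaneDrawing G) (n p : ℕ) : Prop :=
  G.Connected ∧ ∃ F₀ ∈ D.faces, D.IsPolygonalFace n F₀ ∧
    (∀ F ∈ D.faces \ {F₀}, D.IsPolygonalFace 5 F) ∧ (D.faces \ {F₀}).encard = p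

end PlaneDrawing

/-- The set of all `p` such that some 3-connected pentagulation of an `n`-gon (a finite simple
graph) has exactly `p` pentagons. -/
def pentagonCounts (n : ℕ) : Set ℕ :=
  {p | ∃ (V : Type) (_ : Finite V) (G : SimpleGraph V), IsKConnected G 3 ∧
    ∃ D : PlaneDrawing G, D.IsPentagulation n p}

/-- The number of pentagons in a minimal 3-connected pentagulation of an `n`-gon. This is the
minimum of `pentagonCounts n` whenever that set is non-empty. -/
noncomputable def Pg (n : ℕ) : ℕ := sInf (pentagonCounts n)

/-! The bound comes from an explicit graph with three layers. Inside the outer `n`-cycle of the `o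
i` lies a ring of `2 * n` vertices `r i`. Its even vertices carry spokes to the outer cycle, its odd
ones spokes to a closed walk of length `n` around a cactus in the middle. The annulus between outer
cycle and ring is cut into `n` pentagons `o i, o (i+1), r (2i+2), r (2i+1), r (2i)`, and the ring
and the walk likewise bound `n` pentagons. The cactus consists of `k - 1` pentagons and one cycle of
length `5 + 3 * l`, any two of which meet only in the centre `w`; `l` chords from `w` cut the long
cycle into `l + 1` pentagons. In total there are `2n + (k - 1) + (l + 1) = 11k + 7l` pentagons
(`Vert.mem_pentagonCounts`). The assumptions on `n` and `l` force `k ≥ 1`.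

The graph is 3-connected (`isKConnected_three`) by a count of the deleted ring vertices. If there is
none, everything hangs on the ring by spokes. If there is one, the ring is still a path, and a
vertex of the walk or outer cycle that lost its spoke has a surviving neighbour with a spoke. If
there are two, the outer cycle and the walk are intact and some surviving ring edge with its spokes
joins them.

For the drawing, the path from `o 0` to `o (n - 1)` is placed on the real axis, and the graph grows
by ears (`IsLayered.ear`): a path between two vertices of the upper boundary is drawn above it and
cuts off one pentagon. The upper boundary is always the graph of a continuous function, so every
bounded face is the region between two such graphs; its connectedness and its frontier are
elementary, and no Jordan curve theorem is needed. When the upper boundary has shrunk to the edge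
from `o 0` to `o (n - 1)`, the unbounded face is bounded by the `n`-cycle
(`Layered.exists_isPentagulation`). -/

/-- The set of edges traversed by a path that is given as the list of its vertices. -/
def pathEdges {V : Type} : List V → Set (Sym2 V)
  | [] => ∅
  | [_] => ∅
  | a :: b :: t => insert s(a, b) (pathEdges (b :: t))

/-! ### Paths as vertex lists, and the cycles they close up to -/

section PathEdges

variable {V : Type}

@[simp] theorem pathEdges_singleton (a : V) : pathEdges [a] = ∅ := rfl

@[simp] theorem pathEdges_cons_cons (a b : V) (t : List V) :
    pathEdges (a :: b :: t) = insert s(a, b) (pathEdges (b :: t)) := rfl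

theorem exists_split_of_mem_pathEdges {e : Sym2 V} :
    ∀ {L : List V}, e ∈ pathEdges L → ∃ P u v Q, L = P ++ u :: v :: Q ∧ e = s(u, v)
  | [], h => h.elim
  | [_], h => h.elim
  | a :: b :: t, h => by
    rcases h with h | h
    · exact ⟨[], a, b, t, rfl, h⟩
    · obtain ⟨P, u, v, Q, h1, h2⟩ := exists_split_of_mem_pathEdges h
      exact ⟨a :: P, u, v, Q, by rw [h1]; rfl, h2⟩

theorem mem_of_mem_pathEdges {e : Sym2 V} {L : List V} (h : e ∈ pathEdges L) {v : V}
    (hv : v ∈ e) : v ∈ L := by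
  obtain ⟨P, u, w, Q, rfl, rfl⟩ := exists_split_of_mem_pathEdges h
  rcases Sym2.mem_iff.1 hv with rfl | rfl <;> simp

theorem pathEdges_append (a : V) (Q : List V) :
    ∀ P : List V, pathEdges (P ++ a :: Q) = pathEdges (P ++ [a]) ∪ pathEdges (a :: Q)
  | [] => by simp
  | [x] => by simp
  | x :: y :: P => by
    have := pathEdges_append a Q (y :: P)
    simp only [List.cons_append, pathEdges_cons_cons] at this ⊢
    rw [this, Set.insert_union]

theorem pathEdges_reverse : ∀ L : List V, pathEdges L.reverse = pathEdges L
  | [] => rfl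
  | [_] => rfl
  | a :: b :: t => by
    have := pathEdges_reverse (b :: t)
    rw [List.reverse_cons] at this
    rw [List.reverse_cons, List.reverse_cons, List.append_assoc, List.singleton_append,
      pathEdges_append, this]
    ext e
    simp [Sym2.eq_swap, or_comm]

theorem pathEdges_map {W : Type} (f : V → W) :
    ∀ L : List V, pathEdges (L.map f) = Sym2.map f '' pathEdges L
  | [] => by simp [pathEdges]
  | [_] => by simp
  | a :: b :: t => by
    have := pathEdges_map f (b :: t)
    simp only [List.map_cons, pathEdges_cons_cons, Set.image_insert_eq, Sym2.map_mk] at this ⊢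
    rw [this]

theorem exists_walk_of_pathEdges {G : SimpleGraph V} (b : V) :
    ∀ (L : List V) (a : V), pathEdges (a :: L ++ [b]) ⊆ G.edgeSet →
      ∃ p : G.Walk a b, p.support = a :: L ++ [b] ∧ {e | e ∈ p.edges} = pathEdges (a :: L ++ [b])
  | [], a, h => by
    have hab : G.Adj a b := (SimpleGraph.mem_edgeSet G).1 (h (by simp))
    exact ⟨.cons hab .nil, by simp, by ext; simp⟩
  | x :: L, a, h => by
    simp only [List.cons_append, pathEdges_cons_cons] at h
    obtain ⟨p, hp, hpe⟩ := exists_walk_of_pathEdges b L x (fun e he => h (Or.inr he))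
    have hax : G.Adj a x := h (Or.inl rfl)
    refine ⟨.cons hax p, by simp [hp], ?_⟩
    simp only [List.cons_append, pathEdges_cons_cons] at hpe ⊢
    rw [← hpe]
    ext e
    simp

/-- A list of at least three distinct vertices, cyclically adjacent, is traversed by a cycle. -/
theorem exists_isCycle_of_pathEdges {G : SimpleGraph V} {a : V} {t : List V}
    (hnd : (a :: t).Nodup) (hlen : 2 ≤ t.length) (hG : pathEdges (a :: t ++ [a]) ⊆ G.edgeSet) :
    ∃ (v : V) (c : G.Walk v v), c.IsCycle ∧ c.length = t.length + 1 ∧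
      {e | e ∈ c.edges} = pathEdges (a :: t ++ [a]) := by
  obtain ⟨t', b, rfl⟩ : ∃ t' b, t = t' ++ [b] := by
    have : t ≠ [] := by rintro rfl; simp at hlen
    exact ⟨t.dropLast, t.getLast this, (List.dropLast_append_getLast this).symm⟩
  have hE : pathEdges (a :: (t' ++ [b]) ++ [a]) = insert s(b, a) (pathEdges (a :: t' ++ [b])) := by
    have := pathEdges_append b [a] (a :: t')
    simp only [List.cons_append, List.append_assoc, List.nil_append] at this ⊢
    rw [this]
    ext e
    simp [or_comm]
  rw [hE] at hG ⊢
  obtain ⟨p, hp, hpe⟩ := exists_walk_of_pathEdges b t' a (fun e he => hG (Or.inr he))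
  have hba : G.Adj b a := hG (Or.inl rfl)
  refine ⟨b, .cons hba p, ?_, ?_, ?_⟩
  · rw [SimpleGraph.Walk.cons_isCycle_iff, SimpleGraph.Walk.isPath_def, hp]
    refine ⟨hnd, fun h => ?_⟩
    have h' : s(b, a) ∈ pathEdges (a :: t' ++ [b]) := hpe ▸ h
    -- The length bound makes `t'` nonempty. The closing edge is then not the first edge of the
    -- path, and `a` lies on no other.
    match t', hlen, hnd, h' with
    | x :: t'', _, hnd, h' =>
      simp only [List.cons_append, pathEdges_cons_cons] at h'
      rcases h' with h' | h'
      · rcases Sym2.eq_iff.1 h' with ⟨rfl, rfl⟩ | ⟨rfl, -⟩ <;> simp at hnd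
      · have := mem_of_mem_pathEdges h' (Sym2.mem_mk_right b a)
        exact (List.nodup_cons.1 hnd).1 this
  · have := congrArg List.length hp
    simp only [SimpleGraph.Walk.length_support, List.length_append, List.length_cons,
      List.length_nil] at this
    simp [this]
  · ext e
    have : e ∈ p.edges ↔ e ∈ pathEdges (a :: t' ++ [b]) := by rw [← hpe]; rfl
    simp only [SimpleGraph.Walk.edges_cons, List.mem_cons, Set.mem_ofPred_eq, this,
      Set.mem_insert_iff]

end PathEdges

/-! ### Regions between graphs of functions -/

section Geometry

open Set

/-- The part of the graph of `g` over the interval `[a, b]`. -/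
def graphOver (g : ℝ → ℝ) (a b : ℝ) : Set ℂ := {z | a ≤ z.re ∧ z.re ≤ b ∧ z.im = g z.re}

/-- The points over `[0, 1]` between the real axis and the graph of `g`. -/
def subgraph (g : ℝ → ℝ) : Set ℂ := {z | 0 ≤ z.re ∧ z.re ≤ 1 ∧ 0 ≤ z.im ∧ z.im ≤ g z.re}

/-- The open region over `(a, b)` between the graphs of `f` and `g`. -/
def openBetween (f g : ℝ → ℝ) (a b : ℝ) : Set ℂ :=
  {z | a < z.re ∧ z.re < b ∧ f z.re < z.im ∧ z.im < g z.re}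

theorem graphOver_union {g : ℝ → ℝ} {a b c : ℝ} (hab : a ≤ b) (hbc : b ≤ c) :
    graphOver g a b ∪ graphOver g b c = graphOver g a c := by
  ext z
  simp only [graphOver, mem_union, mem_ofPred_eq]
  constructor
  · rintro (⟨h1, h2, h3⟩ | ⟨h1, h2, h3⟩)
    · exact ⟨h1, h2.trans hbc, h3⟩
    · exact ⟨hab.trans h1, h2, h3⟩
  · rintro ⟨h1, h2, h3⟩
    rcases le_total z.re b with h | h
    · exact Or.inl ⟨h1, h, h3⟩
    · exact Or.inr ⟨h, h2, h3⟩

theorem isClosed_subgraph {g : ℝ → ℝ} (hg : Continuous g) : IsClosed (subgraph g) := by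
  refine (isClosed_le continuous_const Complex.continuous_re).inter
    ((isClosed_le Complex.continuous_re continuous_const).inter
      ((isClosed_le continuous_const Complex.continuous_im).inter
        (isClosed_le Complex.continuous_im (hg.comp Complex.continuous_re))))

theorem isOpen_openBetween {f g : ℝ → ℝ} (hf : Continuous f) (hg : Continuous g) (a b : ℝ) :
    IsOpen (openBetween f g a b) := by
  refine (isOpen_lt continuous_const Complex.continuous_re).inter
    ((isOpen_lt Complex.continuous_re continuous_const).inter
      ((isOpen_lt (hf.comp Complex.continuous_re) Complex.continuous_im).inter
        (isOpen_lt Complex.continuous_im (hg.comp Complex.continuous_re))))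

/-- The parametrization of a region between two graphs by a rectangle. -/
def regionMap (f g : ℝ → ℝ) (p : ℝ × ℝ) : ℂ := ⟨p.1, f p.1 + p.2 * (g p.1 - f p.1)⟩

theorem continuous_regionMap {f g : ℝ → ℝ} (hf : Continuous f) (hg : Continuous g) :
    Continuous (regionMap f g) := by
  have : regionMap f g = fun p : ℝ × ℝ =>
      (p.1 : ℂ) + ((f p.1 + p.2 * (g p.1 - f p.1) : ℝ) : ℂ) * Complex.I := by
    funext p
    apply Complex.ext <;> simp [regionMap]
  rw [this]
  fun_prop

theorem openBetween_eq_image {f g : ℝ → ℝ} {a b : ℝ} (hfg : ∀ x ∈ Ioo a b, f x < g x) :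
    openBetween f g a b = regionMap f g '' (Ioo a b ×ˢ Ioo 0 1) := by
  ext z
  constructor
  · rintro ⟨h1, h2, h3, h4⟩
    have hpos : 0 < g z.re - f z.re := sub_pos.2 (h3.trans h4)
    refine ⟨(z.re, (z.im - f z.re) / (g z.re - f z.re)), ⟨⟨h1, h2⟩, ?_, ?_⟩, ?_⟩
    · exact div_pos (sub_pos.2 h3) hpos
    · rw [div_lt_one hpos]; linarith
    · apply Complex.ext
      · rfl
      · simp only [regionMap]
        field_simp
        ring
  · rintro ⟨⟨x, t⟩, ⟨hx, ht0, ht1⟩, rfl⟩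
    have := sub_pos.2 (hfg x hx)
    refine ⟨hx.1, hx.2, ?_, ?_⟩
    · simp only [regionMap]; simp only at ht0 ht1; nlinarith
    · simp only [regionMap]; simp only at ht0 ht1; nlinarith

theorem isPreconnected_openBetween {f g : ℝ → ℝ} (hf : Continuous f) (hg : Continuous g)
    {a b : ℝ} (hfg : ∀ x ∈ Ioo a b, f x < g x) : IsPreconnected (openBetween f g a b) := by
  rw [openBetween_eq_image hfg]
  exact (isPreconnected_Ioo.prod isPreconnected_Ioo).image _ (continuous_regionMap hf hg).continuousOn

/-- Both graphs lie in the closure because the region is the image of an open rectangle under a map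
that is continuous on the closed one. Since `f` and `g` agree at `a` and `b`, no vertical segments
enter the frontier. -/
theorem frontier_openBetween {f g : ℝ → ℝ} (hf : Continuous f) (hg : Continuous g)
    {a b : ℝ} (hab : a < b) (hfg : ∀ x ∈ Ioo a b, f x < g x) (ha : f a = g a) (hb : f b = g b) :
    frontier (openBetween f g a b) = graphOver f a b ∪ graphOver g a b := by
  rw [(isOpen_openBetween hf hg a b).frontier_eq]
  apply Subset.antisymm
  · rintro z ⟨hz, hz'⟩
    have hsub : openBetween f g a b ⊆
        {z : ℂ | a ≤ z.re ∧ z.re ≤ b ∧ f z.re ≤ z.im ∧ z.im ≤ g z.re} :=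
      fun z h => ⟨h.1.le, h.2.1.le, h.2.2.1.le, h.2.2.2.le⟩
    have hcl : IsClosed {z : ℂ | a ≤ z.re ∧ z.re ≤ b ∧ f z.re ≤ z.im ∧ z.im ≤ g z.re} :=
      (isClosed_le continuous_const Complex.continuous_re).inter
        ((isClosed_le Complex.continuous_re continuous_const).inter
          ((isClosed_le (hf.comp Complex.continuous_re) Complex.continuous_im).inter
            (isClosed_le Complex.continuous_im (hg.comp Complex.continuous_re))))
    obtain ⟨h1, h2, h3, h4⟩ := closure_minimal hsub hcl hz
    by_cases hf' : z.im = f z.re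
    · exact Or.inl ⟨h1, h2, hf'⟩
    by_cases hg' : z.im = g z.re
    · exact Or.inr ⟨h1, h2, hg'⟩
    exfalso
    have h3' := lt_of_le_of_ne h3 (Ne.symm hf')
    have h4' := lt_of_le_of_ne h4 hg'
    rcases h1.eq_or_lt with h | h
    · rw [← h, ha] at h3'; rw [← h] at h4'; exact lt_asymm h3' h4'
    rcases h2.eq_or_lt with h' | h'
    · rw [h', hb] at h3'; rw [h'] at h4'; exact lt_asymm h3' h4'
    exact hz' ⟨h, h', h3', h4'⟩
  · have key : ∀ x ∈ Icc a b, ∀ t ∈ Icc (0 : ℝ) 1,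
        regionMap f g (x, t) ∈ closure (openBetween f g a b) := by
      intro x hx t ht
      rw [openBetween_eq_image hfg]
      apply image_closure_subset_closure_image (continuous_regionMap hf hg)
      refine ⟨(x, t), ?_, rfl⟩
      rw [closure_prod_eq, closure_Ioo hab.ne, closure_Ioo zero_ne_one]
      exact ⟨hx, ht⟩
    rintro z (⟨h1, h2, h3⟩ | ⟨h1, h2, h3⟩)
    · refine ⟨?_, fun h => h.2.2.1.ne' h3⟩
      convert key z.re ⟨h1, h2⟩ 0 ⟨le_rfl, zero_le_one⟩ using 1
      apply Complex.ext <;> simp [regionMap, h3]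
    · refine ⟨?_, fun h => h.2.2.2.ne h3⟩
      convert key z.re ⟨h1, h2⟩ 1 ⟨zero_le_one, le_rfl⟩ using 1
      apply Complex.ext <;> simp [regionMap, h3]

theorem frontier_compl_subgraph {g : ℝ → ℝ} (hg : Continuous g) (h0 : ∀ x, 0 ≤ g x)
    (hout : ∀ x, x ∉ Ioo (0 : ℝ) 1 → g x = 0) :
    frontier (subgraph g)ᶜ = graphOver (fun _ => 0) 0 1 ∪ graphOver g 0 1 := by
  rw [frontier_compl, (isClosed_subgraph hg).frontier_eq]
  have hopen : IsOpen (openBetween (fun _ => 0) g 0 1) :=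
    isOpen_openBetween continuous_const hg 0 1
  apply Subset.antisymm
  · rintro z ⟨⟨h1, h2, h3, h4⟩, hz⟩
    by_contra hcon
    simp only [graphOver, mem_union, mem_ofPred_eq, h1, h2, true_and, not_or] at hcon
    apply hz
    have hlt := lt_of_le_of_ne h3 (Ne.symm hcon.1)
    have hlt' := lt_of_le_of_ne h4 hcon.2
    have hio : z.re ∈ Ioo (0 : ℝ) 1 := by
      by_contra h
      rw [hout _ h] at h4
      exact hcon.1 (le_antisymm h4 h3)
    have hsub : openBetween (fun _ => 0) g 0 1 ⊆ subgraph g :=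
      fun z h => ⟨h.1.le, h.2.1.le, h.2.2.1.le, h.2.2.2.le⟩
    exact interior_maximal hsub hopen ⟨hio.1, hio.2, hlt, hlt'⟩
  -- A point is not interior if moving it vertically by arbitrarily small amounts leaves the set:
  -- downwards from the axis, upwards from the graph of `g`.
  · have key : ∀ (z : ℂ) (d : ℝ), (∀ ε > 0, z + ((ε * d : ℝ) : ℂ) * Complex.I ∉ subgraph g) →
        z ∉ interior (subgraph g) := by
      intro z d h hz
      rw [mem_interior_iff_mem_nhds] at hz
      have hc : Filter.Tendsto (fun ε : ℝ => z + ((ε * d : ℝ) : ℂ) * Complex.I)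
          (nhdsWithin 0 (Ioi 0)) (nhds z) := by
        have : Continuous (fun ε : ℝ => z + ((ε * d : ℝ) : ℂ) * Complex.I) := by fun_prop
        have := (this.tendsto 0).mono_left (nhdsWithin_le_nhds (s := Ioi 0))
        simpa using this
      obtain ⟨ε, h2, h3⟩ := ((hc.eventually hz).and self_mem_nhdsWithin).exists
      exact h ε h3 h2
    rintro z (⟨h1, h2, h3⟩ | ⟨h1, h2, h3⟩)
    · refine ⟨⟨h1, h2, h3.ge, h3 ▸ h0 _⟩, key z (-1) fun ε hε h => ?_⟩
      have := h.2.2.1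
      simp [h3] at this
      linarith
    · refine ⟨⟨h1, h2, h3 ▸ h0 _, h3.le⟩, key z 1 fun ε hε h => ?_⟩
      have := h.2.2.2
      simp [h3] at this
      linarith

/-- The complement is covered by the region above the graph of `g`, the lower half-plane and the
half-planes left of `0` and right of `1`. The three points chosen below lie in overlaps that chain
these four sets together. -/
theorem isPreconnected_compl_subgraph {g : ℝ → ℝ} (hg : Continuous g)
    (hout : ∀ x, x ∉ Ioo (0 : ℝ) 1 → g x = 0) : IsPreconnected (subgraph g)ᶜ := by
  let Φ : ℝ × ℝ → ℂ := fun p => (p.1 : ℂ) + ((g p.1 + p.2 : ℝ) : ℂ) * Complex.I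
  have hΦ : Continuous Φ := by fun_prop
  have hU : IsPreconnected {z : ℂ | g z.re < z.im} := by
    have : {z : ℂ | g z.re < z.im} = Φ '' (univ ×ˢ Ioi 0) := by
      ext z
      constructor
      · intro h
        exact ⟨(z.re, z.im - g z.re), ⟨trivial, mem_Ioi.2 (sub_pos.2 h)⟩, by apply Complex.ext <;> simp [Φ]⟩
      · rintro ⟨⟨x, t⟩, ⟨-, ht⟩, rfl⟩
        simpa [Φ] using ht
    rw [this]
    exact (isPreconnected_univ.prod isPreconnected_Ioi).image _ hΦ.continuousOn
  have hL : IsPreconnected {z : ℂ | z.im < 0} := (convex_halfSpace_im_lt 0).isPreconnected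
  have hA : IsPreconnected {z : ℂ | z.re < 0} := (convex_halfSpace_re_lt 0).isPreconnected
  have hB : IsPreconnected {z : ℂ | 1 < z.re} := (convex_halfSpace_re_gt 1).isPreconnected
  have h1 := IsPreconnected.union (⟨-1, 1⟩ : ℂ) (by simp)
    (by simp [hout (-1) (by simp)]) hA hU
  have h2 := IsPreconnected.union (⟨2, 1⟩ : ℂ)
    (Or.inr (by simp [hout 2 (by simp)])) (by norm_num) h1 hB
  have h3 := IsPreconnected.union (⟨-1, -1⟩ : ℂ)
    (Or.inl (Or.inl (by norm_num))) (by norm_num) h2 hL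
  convert h3 using 1
  ext z
  simp only [subgraph, mem_compl_iff, mem_ofPred_eq, mem_union, not_and_or, not_le]
  have key : ¬ z.re ∈ Ioo (0 : ℝ) 1 → g z.re = 0 := hout _
  tauto

/-- If a set is the union of a family of pairwise disjoint nonempty connected open sets, these are
its connected components. -/
theorem components_eq {X : Type*} [TopologicalSpace X] {A : Set X} {𝓕 : Set (Set X)}
    (hA : A = ⋃₀ 𝓕) (hopen : ∀ F ∈ 𝓕, IsOpen F) (hconn : ∀ F ∈ 𝓕, IsPreconnected F)
    (hne : ∀ F ∈ 𝓕, F.Nonempty) (hdisj : 𝓕.PairwiseDisjoint id) :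
    {F | ∃ z ∈ A, F = connectedComponentIn A z} = 𝓕 := by
  have key : ∀ F ∈ 𝓕, ∀ z ∈ F, connectedComponentIn A z = F := by
    intro F hF z hz
    have hFA : F ⊆ A := hA ▸ subset_sUnion_of_mem hF
    apply Subset.antisymm
    · refine IsPreconnected.subset_left_of_subset_union (hopen F hF)
        (isOpen_sUnion (s := 𝓕 \ {F}) fun F' h => hopen F' h.1) ?_ ?_
        ⟨z, mem_connectedComponentIn (hFA hz), hz⟩ isPreconnected_connectedComponentIn
      · rw [disjoint_sUnion_right]
        exact fun F' h => hdisj hF h.1 (Ne.symm h.2)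
      · refine (connectedComponentIn_subset A z).trans ?_
        rw [hA]
        rintro x ⟨F', h, hx⟩
        by_cases hFF : F' = F
        · exact Or.inl (hFF ▸ hx)
        · exact Or.inr ⟨F', ⟨h, hFF⟩, hx⟩
    · exact (hconn F hF).subset_connectedComponentIn hz hFA
  ext F
  constructor
  · rintro ⟨z, hz, rfl⟩
    rw [hA] at hz
    obtain ⟨F, hF, hzF⟩ := hz
    rwa [key F hF z hzF]
  · intro hF
    obtain ⟨z, hz⟩ := hne F hF
    exact ⟨z, hA ▸ ⟨F, hF, hz⟩, (key F hF z hz).symm⟩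

end Geometry

/-! ### Paths drawn from left to right on the graph of a function -/

section GraphPaths

open Set

variable {V : Type}

/-- The drawing of the edge `e` on the graph of `g`, when the vertices have abscissas `x`. -/
def graphArc (g : ℝ → ℝ) (x : V → ℝ) (e : Sym2 V) : Set ℂ :=
  {z | z.im = g z.re ∧ ∃ u v, e = s(u, v) ∧ x u ≤ z.re ∧ z.re ≤ x v}

theorem graphArc_eq {g : ℝ → ℝ} {x : V → ℝ} {u v : V} (h : x u < x v) :
    graphArc g x s(u, v) = graphOver g (x u) (x v) := by
  ext z
  constructor
  · rintro ⟨h1, u', v', he, h2, h3⟩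
    rcases Sym2.eq_iff.1 he with ⟨rfl, rfl⟩ | ⟨rfl, rfl⟩
    · exact ⟨h2, h3, h1⟩
    · linarith
  · rintro ⟨h1, h2, h3⟩
    exact ⟨h3, u, v, rfl, h1, h2⟩

/-- `γ` is an injective path from `p` to `q` with range `A`. -/
def IsSimpleArc (p q : ℂ) (A : Set ℂ) : Prop :=
  ∃ γ : unitInterval → ℂ, Continuous γ ∧ Function.Injective γ ∧ γ 0 = p ∧ γ 1 = q ∧ A = range γ

theorem IsSimpleArc.symm {p q : ℂ} {A : Set ℂ} (h : IsSimpleArc p q A) : IsSimpleArc q p A := by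
  obtain ⟨γ, h1, h2, h3, h4, h5⟩ := h
  refine ⟨γ ∘ unitInterval.symm, h1.comp unitInterval.continuous_symm,
    h2.comp unitInterval.symm_bijective.injective, by simp [h4], by simp [h3], ?_⟩
  rw [unitInterval.symm_bijective.surjective.range_comp, h5]

theorem isSimpleArc_graphOver {g : ℝ → ℝ} (hg : Continuous g) {a b : ℝ} (hab : a < b) :
    IsSimpleArc ⟨a, g a⟩ ⟨b, g b⟩ (graphOver g a b) := by
  have hb : 0 < b - a := sub_pos.2 hab
  refine ⟨fun t => ((a + t * (b - a) : ℝ) : ℂ) + ((g (a + t * (b - a)) : ℝ) : ℂ) * Complex.I,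
    by fun_prop, ?_, ?_, ?_, ?_⟩
  · intro s t h
    have := congrArg Complex.re h
    simp at this
    rcases this with h | h
    · exact Subtype.ext h
    · linarith
  · apply Complex.ext <;> simp
  · apply Complex.ext <;> simp
  · ext z
    constructor
    · rintro ⟨h1, h2, h3⟩
      refine ⟨⟨(z.re - a) / (b - a), div_nonneg (by linarith) hb.le,
        (div_le_one hb).2 (by linarith)⟩, ?_⟩
      have : a + (z.re - a) / (b - a) * (b - a) = z.re := by field_simp; ring
      simp only [this]
      apply Complex.ext <;> simp [h3]
    · rintro ⟨⟨t, h0, h1⟩, rfl⟩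
      refine ⟨?_, ?_, ?_⟩
      · simp; positivity
      · simp; nlinarith
      · simp

/-- The path `L` is drawn on the graph of `g`, from left to right. -/
structure IsGraphPath (x : V → ℝ) (arc : Sym2 V → Set ℂ) (g : ℝ → ℝ) (L : List V) : Prop where
  pairwise : L.Pairwise fun u v => x u < x v
  arc_eq : ∀ u v, s(u, v) ∈ pathEdges L → x u < x v → arc s(u, v) = graphOver g (x u) (x v)

namespace IsGraphPath

variable {x : V → ℝ} {arc : Sym2 V → Set ℂ} {g : ℝ → ℝ} {L : List V}

theorem eq_of_eq (h : IsGraphPath x arc g L) {u v : V} (hu : u ∈ L) (hv : v ∈ L)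
    (huv : x u = x v) : u = v := by
  have hp := h.pairwise
  clear h
  induction L with
  | nil => simp at hu
  | cons a t ih =>
    rw [List.pairwise_cons] at hp
    rcases List.mem_cons.1 hu with rfl | hu' <;> rcases List.mem_cons.1 hv with rfl | hv'
    · rfl
    · exact absurd huv (hp.1 v hv').ne
    · exact absurd huv (hp.1 u hu').ne'
    · exact ih hu' hv' hp.2

theorem exists_ends (h : IsGraphPath x arc g L) {e : Sym2 V} (he : e ∈ pathEdges L) :
    ∃ u v, e = s(u, v) ∧ u ∈ L ∧ v ∈ L ∧ x u < x v ∧ arc e = graphOver g (x u) (x v) ∧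
      ∀ w ∈ L, x w ≤ x u ∨ x v ≤ x w := by
  obtain ⟨P, u, v, Q, hL, rfl⟩ := exists_split_of_mem_pathEdges he
  have hp := h.pairwise
  rw [hL] at hp
  simp only [List.pairwise_append, List.pairwise_cons, List.mem_cons] at hp
  obtain ⟨-, ⟨h1, h2, -⟩, h3⟩ := hp
  have huv := h1 v (Or.inl rfl)
  refine ⟨u, v, rfl, by simp [hL], by simp [hL], huv, h.arc_eq u v he huv, ?_⟩
  intro w hw
  rw [hL] at hw
  simp only [List.mem_append, List.mem_cons] at hw
  rcases hw with hw | rfl | rfl | hw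
  · exact Or.inl (h3 w hw u (Or.inl rfl)).le
  · exact Or.inl le_rfl
  · exact Or.inr le_rfl
  · exact Or.inr (h2 w hw).le

/-- No vertex of the path has its abscissa strictly between those of two consecutive vertices. -/
theorem mem_of_re_eq (h : IsGraphPath x arc g L) {e : Sym2 V} (he : e ∈ pathEdges L) {w : V}
    (hw : w ∈ L) {z : ℂ} (hz : z ∈ arc e) (hzw : z.re = x w) : w ∈ e := by
  obtain ⟨u, v, rfl, hu, hv, huv, ha, hgap⟩ := h.exists_ends he
  rw [ha] at hz
  obtain ⟨h1, h2, -⟩ := hz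
  rcases hgap w hw with h' | h'
  · rw [h.eq_of_eq hw hu (by linarith)]; exact Sym2.mem_mk_left _ _
  · rw [h.eq_of_eq hw hv (by linarith)]; exact Sym2.mem_mk_right _ _

theorem exists_of_mem_inter (h : IsGraphPath x arc g L) {e f : Sym2 V} (he : e ∈ pathEdges L)
    (hf : f ∈ pathEdges L) (hef : e ≠ f) {z : ℂ} (hze : z ∈ arc e) (hzf : z ∈ arc f) :
    ∃ v ∈ L, v ∈ e ∧ v ∈ f ∧ z.re = x v := by
  have key : ∃ v ∈ L, z.re = x v := by
    obtain ⟨u, v, rfl, hu, hv, huv, ha, hgap⟩ := h.exists_ends he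
    obtain ⟨u', v', rfl, hu', hv', huv', ha', hgap'⟩ := h.exists_ends hf
    rw [ha] at hze
    rw [ha'] at hzf
    obtain ⟨h1, h2, -⟩ := hze
    obtain ⟨h1', h2', -⟩ := hzf
    rcases hgap u' hu' with h3 | h3
    · rcases hgap' u hu with h4 | h4
      · have huu := h.eq_of_eq hu hu' (le_antisymm h4 h3)
        subst huu
        exfalso
        apply hef
        rcases hgap v' hv' with h5 | h5
        · linarith
        · rcases hgap' v hv with h6 | h6
          · linarith
          · rw [h.eq_of_eq hv hv' (le_antisymm h5 h6)]
      · exact ⟨u, hu, by linarith⟩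
    · exact ⟨u', hu', by linarith⟩
  obtain ⟨v, hv, hzv⟩ := key
  exact ⟨v, hv, h.mem_of_re_eq he hv hze hzv, h.mem_of_re_eq hf hv hzf hzv, hzv⟩

theorem of_append_left {P : List V} {a : V} {Q : List V} (h : IsGraphPath x arc g (P ++ a :: Q)) :
    IsGraphPath x arc g (P ++ [a]) := by
  refine ⟨h.pairwise.sublist (by simp), fun u v he => h.arc_eq u v ?_⟩
  rw [pathEdges_append]
  exact Or.inl he

theorem of_append_right {P : List V} {a : V} {Q : List V}
    (h : IsGraphPath x arc g (P ++ a :: Q)) : IsGraphPath x arc g (a :: Q) := by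
  refine ⟨h.pairwise.sublist (by simp), fun u v he => h.arc_eq u v ?_⟩
  rw [pathEdges_append]
  exact Or.inr he

theorem iUnion_arc {b : V} : ∀ {t : List V} {a : V}, IsGraphPath x arc g (a :: (t ++ [b])) →
    ⋃ e ∈ pathEdges (a :: (t ++ [b])), arc e = graphOver g (x a) (x b)
  | [], a, h => by
    have hab := (List.pairwise_cons.1 h.pairwise).1 b (by simp)
    simpa using h.arc_eq a b (by simp) hab
  | c :: t, a, h => by
    have hac := (List.pairwise_cons.1 h.pairwise).1 c (by simp)
    have h' : IsGraphPath x arc g (c :: (t ++ [b])) := h.of_append_right (P := [a])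
    have hcb := (List.pairwise_cons.1 h'.pairwise).1 b (by simp)
    have := iUnion_arc h'
    rw [List.cons_append, pathEdges_cons_cons, biUnion_insert, this,
      h.arc_eq a c (by simp) hac, graphOver_union hac.le hcb.le]

/-- This carries over the parts of the upper boundary to the left and to the right of a new ear,
where points, arcs and the function stay as they were. -/
theorem congr {x' : V → ℝ} {arc' : Sym2 V → Set ℂ} {g' : ℝ → ℝ} (h : IsGraphPath x arc g L)
    (hx : ∀ v ∈ L, x' v = x v) (harc : ∀ e ∈ pathEdges L, arc' e = arc e) {a b : ℝ}
    (hL : ∀ v ∈ L, a ≤ x v ∧ x v ≤ b) (hg : ∀ t, a ≤ t → t ≤ b → g' t = g t) :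
    IsGraphPath x' arc' g' L := by
  refine ⟨h.pairwise.imp_of_mem fun hu hv h => by rwa [hx _ hu, hx _ hv], fun u v he huv => ?_⟩
  have hu := mem_of_mem_pathEdges he (Sym2.mem_mk_left u v)
  have hv := mem_of_mem_pathEdges he (Sym2.mem_mk_right u v)
  rw [hx u hu, hx v hv] at huv ⊢
  rw [harc _ he, h.arc_eq u v he huv]
  ext z
  simp only [graphOver, mem_ofPred_eq]
  refine and_congr_right fun h1 => and_congr_right fun h2 => ?_
  rw [hg z.re ((hL u hu).1.trans h1) (h2.trans (hL v hv).2)]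

theorem append {P : List V} {a : V} {Q : List V} (h1 : IsGraphPath x arc g (P ++ [a]))
    (h2 : IsGraphPath x arc g (a :: Q)) : IsGraphPath x arc g (P ++ a :: Q) := by
  constructor
  · have p1 := h1.pairwise
    have p2 := h2.pairwise
    simp only [List.pairwise_append, List.pairwise_cons, List.mem_cons]
      at p1 p2 ⊢
    refine ⟨p1.1, p2, ?_⟩
    rintro u hu v (rfl | hv)
    · exact p1.2.2 u hu _ (Or.inl rfl)
    · exact (p1.2.2 u hu _ (Or.inl rfl)).trans (p2.1 v hv)
  · intro u v he huv
    rw [pathEdges_append] at he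
    rcases he with he | he
    · exact h1.arc_eq u v he huv
    · exact h2.arc_eq u v he huv

end IsGraphPath

theorem exists_abscissas {us : List V} (h : us.Nodup) {a b : ℝ} (hab : a < b) :
    ∃ ξ : V → ℝ, (∀ v ∈ us, a < ξ v ∧ ξ v < b) ∧ us.Pairwise fun u v => ξ u < ξ v := by
  classical
  induction us generalizing a with
  | nil => exact ⟨fun _ => 0, by simp, List.Pairwise.nil⟩
  | cons c t ih =>
    rw [List.nodup_cons] at h
    obtain ⟨ξ, h1, h2⟩ := ih h.2 (a := (a + b) / 2) (by linarith)
    have hne : ∀ v ∈ t, v ≠ c := fun v hv hvc => h.1 (hvc ▸ hv)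
    refine ⟨Function.update ξ c ((a + b) / 2), ?_, ?_⟩
    · intro v hv
      rcases List.mem_cons.1 hv with rfl | hv
      · rw [Function.update_self]; constructor <;> linarith
      · rw [Function.update_of_ne (hne v hv)]
        exact ⟨by linarith [(h1 v hv).1], (h1 v hv).2⟩
    · rw [List.pairwise_cons]
      constructor
      · intro v hv
        rw [Function.update_self, Function.update_of_ne (hne v hv)]
        exact (h1 v hv).1
      · refine h2.imp_of_mem fun hu hv h => ?_
        rwa [Function.update_of_ne (hne _ hu), Function.update_of_ne (hne _ hv)]

end GraphPaths

/-! ### Layered drawings and the initial path -/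

section Layered

open Set

variable {V : Type}

/-- The points covered by a drawing of the vertices `S` and the edges `E`. -/
def covered (S : Set V) (E : Set (Sym2 V)) (pt : V → ℂ) (arc : Sym2 V → Set ℂ) : Set ℂ :=
  pt '' S ∪ ⋃ e ∈ E, arc e

/-- The edges of the closed path `a :: t ++ [a]`, a cycle of length `m`, are drawn on the boundary
of `F`. -/
def IsPolygon (S : Set V) (E : Set (Sym2 V)) (arc : Sym2 V → Set ℂ) (m : ℕ) (F : Set ℂ) : Prop :=
  ∃ (a : V) (t : List V), (a :: t).Nodup ∧ t.length + 1 = m ∧ (∀ v ∈ a :: t, v ∈ S) ∧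
    pathEdges (a :: t ++ [a]) ⊆ E ∧ frontier F = ⋃ e ∈ pathEdges (a :: t ++ [a]), arc e

/-- A drawing without crossings of a graph with vertices `S` and edges `E` between the real axis
and the graph of `g`. The path `B` is drawn on the real axis, the path `top` on the graph of `g`,
and the bounded faces `𝓕` are pentagons. -/
structure IsLayered (B top : List V) (S : Set V) (E : Set (Sym2 V)) (𝓕 : Set (Set ℂ))
    (pt : V → ℂ) (arc : Sym2 V → Set ℂ) (g : ℝ → ℝ) : Prop where
  continuous : Continuous g
  nonneg : ∀ x, 0 ≤ g x
  outside : ∀ x, x ∉ Ioo (0 : ℝ) 1 → g x = 0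
  finite : S.Finite
  ends_mem : ∀ e ∈ E, ∀ v ∈ e, v ∈ S
  injOn : InjOn pt S
  pt_mem : ∀ v ∈ S, pt v ∈ subgraph g
  arc_subset : ∀ e ∈ E, arc e ⊆ subgraph g
  isSimpleArc : ∀ u v, s(u, v) ∈ E → IsSimpleArc (pt u) (pt v) (arc s(u, v))
  mem_of_mem_arc : ∀ e ∈ E, ∀ v ∈ S, pt v ∈ arc e → v ∈ e
  arc_inter_arc : ∀ e ∈ E, ∀ f ∈ E, e ≠ f → ∀ z ∈ arc e ∩ arc f, ∃ v, v ∈ e ∧ v ∈ f ∧ z = pt v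
  top_mem : ∀ v ∈ top, v ∈ S
  top_edges : pathEdges top ⊆ E
  top_im : ∀ v ∈ top, (pt v).im = g (pt v).re
  top_path : IsGraphPath (fun v => (pt v).re) arc g top
  top_head : ∀ v, top.head? = some v → (pt v).re = 0
  top_last : ∀ v, top.getLast? = some v → (pt v).re = 1
  bottom_mem : ∀ v ∈ B, v ∈ S
  bottom_edges : pathEdges B ⊆ E
  bottom_arc : ⋃ e ∈ pathEdges B, arc e = graphOver (fun _ => 0) 0 1
  isOpen_face : ∀ F ∈ 𝓕, IsOpen F
  isPreconnected_face : ∀ F ∈ 𝓕, IsPreconnected F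
  nonempty_face : ∀ F ∈ 𝓕, F.Nonempty
  disjoint_faces : 𝓕.PairwiseDisjoint id
  sUnion_faces : ⋃₀ 𝓕 = subgraph g \ covered S E pt arc
  isPolygon_face : ∀ F ∈ 𝓕, IsPolygon S E arc 5 F

/-- With `g = 0` the region `subgraph g` degenerates to the segment from `0` to `1`, which the path
covers, so there are no bounded faces. -/
theorem isLayered_base {s t : V} {m : List V} (hnd : (s :: (m ++ [t])).Nodup) :
    ∃ pt arc g, IsLayered (s :: (m ++ [t])) (s :: (m ++ [t])) {v | v ∈ s :: (m ++ [t])}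
      (pathEdges (s :: (m ++ [t]))) ∅ pt arc g := by
  classical
  obtain ⟨ξ, hξ, hξp⟩ := exists_abscissas (us := m) (a := 0) (b := 1)
    (by simp only [List.nodup_cons, List.nodup_append] at hnd; exact hnd.2.1) one_pos
  have hsm : s ∉ m := by simp at hnd; tauto
  have htm : t ∉ m := by
    intro h
    simp only [List.nodup_cons, List.nodup_append] at hnd
    exact hnd.2.2.2 t h t (by simp) rfl
  have hst : s ≠ t := by simp at hnd; tauto
  set L := s :: (m ++ [t]) with hL
  let x : V → ℝ := fun v => if v = s then 0 else if v = t then 1 else ξ v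
  have hxs : x s = 0 := if_pos rfl
  have hxt : x t = 1 := by simp [x, hst.symm]
  have hxm : ∀ v ∈ m, x v = ξ v := fun v hv => by
    have h1 : v ≠ s := fun h => hsm (h ▸ hv)
    have h2 : v ≠ t := fun h => htm (h ▸ hv)
    simp [x, h1, h2]
  let g : ℝ → ℝ := fun _ => 0
  let pt : V → ℂ := fun v => ⟨x v, 0⟩
  have hg : Continuous g := continuous_const
  have hpath : IsGraphPath x (graphArc g x) g L := by
    refine ⟨?_, fun u v _ h => graphArc_eq h⟩
    rw [hL, List.pairwise_cons, List.pairwise_append]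
    refine ⟨?_, ?_, List.pairwise_singleton _ _, ?_⟩
    · intro v hv
      rcases List.mem_append.1 hv with hv | hv
      · rw [hxs, hxm v hv]; exact (hξ v hv).1
      · rw [List.mem_singleton.1 hv, hxs, hxt]; exact one_pos
    · exact hξp.imp_of_mem fun hu hv h => by rwa [hxm _ hu, hxm _ hv]
    · intro u hu v hv
      rw [List.mem_singleton.1 hv, hxt, hxm u hu]; exact (hξ u hu).2
  have hx01 : ∀ v ∈ L, 0 ≤ x v ∧ x v ≤ 1 := by
    intro v hv
    simp only [hL, List.mem_cons, List.mem_append, List.not_mem_nil, or_false] at hv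
    rcases hv with rfl | hv | rfl
    · simp [hxs]
    · rw [hxm v hv]; exact ⟨(hξ v hv).1.le, (hξ v hv).2.le⟩
    · simp [hxt]
  have hU : ⋃ e ∈ pathEdges L, graphArc g x e = graphOver g 0 1 := by
    have := hpath.iUnion_arc
    rwa [hxs, hxt] at this
  have hsub : subgraph g = graphOver g 0 1 := by
    ext z
    simp only [subgraph, graphOver, g, mem_ofPred_eq]
    constructor
    · rintro ⟨h1, h2, h3, h4⟩; exact ⟨h1, h2, le_antisymm h4 h3⟩
    · rintro ⟨h1, h2, h3⟩; exact ⟨h1, h2, h3.ge, h3.le⟩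
  have harc : ∀ e ∈ pathEdges L, graphArc g x e ⊆ subgraph g := by
    intro e he
    rw [hsub, ← hU]
    exact subset_biUnion_of_mem (u := graphArc g x) he
  refine ⟨pt, graphArc g x, g, ?_⟩
  constructor
  case continuous => exact hg
  case nonneg => exact fun _ => le_rfl
  case outside => exact fun _ _ => rfl
  case finite => exact L.finite_toSet
  case ends_mem => exact fun e he v hv => mem_of_mem_pathEdges he hv
  case injOn => exact fun u hu v hv h => hpath.eq_of_eq hu hv (congrArg Complex.re h)
  case pt_mem => exact fun v hv => ⟨(hx01 v hv).1, (hx01 v hv).2, le_rfl, le_rfl⟩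
  case arc_subset => exact harc
  case isSimpleArc =>
    intro u v he
    obtain ⟨u', v', he', hu, hv, huv, ha, -⟩ := hpath.exists_ends he
    have := isSimpleArc_graphOver hg huv
    rw [ha]
    rcases Sym2.eq_iff.1 he' with ⟨rfl, rfl⟩ | ⟨rfl, rfl⟩
    · exact this
    · exact this.symm
  case mem_of_mem_arc => exact fun e he v hv h => hpath.mem_of_re_eq he hv h rfl
  case arc_inter_arc =>
    rintro e he f hf hef z ⟨hze, hzf⟩
    obtain ⟨v, hv, h1, h2, h3⟩ := hpath.exists_of_mem_inter he hf hef hze hzf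
    refine ⟨v, h1, h2, Complex.ext h3 ?_⟩
    exact hze.1
  case top_mem => exact fun v hv => hv
  case top_edges => exact Subset.rfl
  case top_im => exact fun v hv => rfl
  case top_path => exact hpath
  case top_head =>
    intro v hv
    simp only [hL, List.head?_cons, Option.some.injEq] at hv
    rw [← hv]; exact hxs
  case top_last =>
    intro v hv
    rw [hL, ← List.cons_append, List.getLast?_concat, Option.some.injEq] at hv
    rw [← hv]; exact hxt
  case bottom_mem => exact fun v hv => hv
  case bottom_edges => exact Subset.rfl
  case bottom_arc => exact hU
  case sUnion_faces =>
    rw [covered, hU, hsub, sUnion_empty, eq_comm, sdiff_eq_empty]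
    exact subset_union_right
  all_goals simp

end Layered

/-! ### Adding an ear to a layered drawing -/

section Ear

open Set

variable {V : Type}

/-- The new upper function exceeds `g` by a bump that is positive exactly between the abscissas of
`l` and `r`. The ear, drawn on its graph, therefore meets the old drawing only in its ends, and the
only new face is the region between the two functions. Its boundary has the vertices `l`, `r`, `M`
and `us`, five by `hlen`. By `hE` no old edge has its arc redefined. -/
theorem IsLayered.ear {B P M Q us : List V} {l r : V} {S : Set V} {E : Set (Sym2 V)}
    {𝓕 : Set (Set ℂ)} {pt : V → ℂ} {arc : Sym2 V → Set ℂ} {g : ℝ → ℝ}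
    (H : IsLayered B (P ++ l :: (M ++ r :: Q)) S E 𝓕 pt arc g) (hus : us.Nodup)
    (hS : ∀ u ∈ us, u ∉ S) (hE : ∀ e ∈ pathEdges (l :: (us ++ [r])), e ∉ E)
    (hlen : M.length + us.length = 3) :
    ∃ R pt' arc' g', R ∉ 𝓕 ∧ IsLayered B (P ++ l :: (us ++ r :: Q)) (S ∪ {v | v ∈ us})
      (E ∪ pathEdges (l :: (us ++ [r]))) (insert R 𝓕) pt' arc' g' := by
  classical
  set N := pathEdges (l :: (us ++ [r])) with hN
  have hlS : l ∈ S := H.top_mem l (by simp)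
  have hrS : r ∈ S := H.top_mem r (by simp)
  have hpw := H.top_path.pairwise
  simp only [List.pairwise_append, List.pairwise_cons, List.mem_cons, List.mem_append] at hpw
  obtain ⟨-, ⟨hlx, -, ⟨hrQ, -⟩, -⟩, hPx⟩ := hpw
  have hlr : (pt l).re < (pt r).re := hlx r (Or.inr (Or.inl rfl))
  obtain ⟨ξ, hξ, hξp⟩ := exists_abscissas hus hlr
  have hl01 := H.pt_mem l hlS
  have hr01 := H.pt_mem r hrS
  -- the new upper function
  let g' : ℝ → ℝ := fun x => g x + max 0 ((x - (pt l).re) * ((pt r).re - x))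
  have hgc : Continuous g := H.continuous
  have hg'c : Continuous g' := by fun_prop
  have hle : ∀ x, g x ≤ g' x := fun x => le_add_of_nonneg_right (le_max_left _ _)
  have hlt : ∀ x ∈ Ioo (pt l).re (pt r).re, g x < g' x := fun x hx =>
    lt_add_of_pos_right _ (lt_max_of_lt_right (mul_pos (sub_pos.2 hx.1) (sub_pos.2 hx.2)))
  have heq : ∀ x, x ∉ Ioo (pt l).re (pt r).re → g' x = g x := by
    intro x hx
    have : (x - (pt l).re) * ((pt r).re - x) ≤ 0 := by
      rw [mem_Ioo, not_and_or, not_lt, not_lt] at hx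
      rcases hx with hx | hx <;> nlinarith
    simp [g', max_eq_left this]
  have heql : g' (pt l).re = g (pt l).re := heq _ fun h => lt_irrefl _ h.1
  have heqr : g' (pt r).re = g (pt r).re := heq _ fun h => lt_irrefl _ h.2
  -- the new points
  let pt' : V → ℂ := fun v => if v ∈ us then ⟨ξ v, g' (ξ v)⟩ else pt v
  have hpt_us : ∀ v ∈ us, pt' v = ⟨ξ v, g' (ξ v)⟩ := fun v hv => if_pos hv
  have hpt_S : ∀ v ∈ S, pt' v = pt v := fun v hv => if_neg fun h => hS v h hv
  let x' : V → ℝ := fun v => (pt' v).re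
  have hx'l : x' l = (pt l).re := by simp only [x', hpt_S l hlS]
  have hx'r : x' r = (pt r).re := by simp only [x', hpt_S r hrS]
  have hx'us : ∀ v ∈ us, x' v = ξ v := fun v hv => by simp only [x', hpt_us v hv]
  -- the new arcs
  let arc' : Sym2 V → Set ℂ := fun e => if e ∈ N then graphArc g' x' e else arc e
  have harc_N : ∀ e ∈ N, arc' e = graphArc g' x' e := fun e he => if_pos he
  have harc_E : ∀ e ∈ E, arc' e = arc e := fun e he => if_neg fun h => hE e h he
  have hpath : IsGraphPath x' arc' g' (l :: (us ++ [r])) := by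
    refine ⟨?_, fun u v he h => by rw [harc_N _ he, graphArc_eq h]⟩
    rw [List.pairwise_cons, List.pairwise_append]
    refine ⟨?_, ?_, List.pairwise_singleton _ _, ?_⟩
    · intro v hv
      rcases List.mem_append.1 hv with hv | hv
      · rw [hx'l, hx'us v hv]; exact (hξ v hv).1
      · rw [List.mem_singleton.1 hv, hx'l, hx'r]; exact hlr
    · exact hξp.imp_of_mem fun hu hv h => by rwa [hx'us _ hu, hx'us _ hv]
    · intro u hu v hv
      rw [List.mem_singleton.1 hv, hx'r, hx'us u hu]; exact (hξ u hu).2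
  have hU' : ⋃ e ∈ N, arc' e = graphOver g' (pt l).re (pt r).re := by
    have := hpath.iUnion_arc
    rwa [hx'l, hx'r] at this
  have hNsub : ∀ e ∈ N, arc' e ⊆ graphOver g' (pt l).re (pt r).re := by
    intro e he
    rw [← hU']
    exact subset_biUnion_of_mem (u := arc') he
  have hNim : ∀ v ∈ l :: (us ++ [r]), (pt' v).im = g' (pt' v).re := by
    intro v hv
    simp only [List.mem_cons, List.mem_append, List.not_mem_nil, or_false] at hv
    rcases hv with rfl | hv | rfl
    · rw [hpt_S _ hlS, heql]; exact H.top_im _ (by simp)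
    · rw [hpt_us v hv]
    · rw [hpt_S _ hrS, heqr]; exact H.top_im _ (by simp)
  -- the old drawing meets the new path only in its ends
  have hlim : (pt l).im = g (pt l).re := H.top_im l (by simp)
  have hrim : (pt r).im = g (pt r).re := H.top_im r (by simp)
  have hmeet : ∀ z ∈ subgraph g, z ∈ graphOver g' (pt l).re (pt r).re → z = pt l ∨ z = pt r := by
    rintro z ⟨-, -, -, h4⟩ ⟨h1, h2, h3⟩
    have hnot : z.re ∉ Ioo (pt l).re (pt r).re := fun h => by
      have := hlt _ h
      linarith
    rcases h1.eq_or_lt with h | h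
    · left
      apply Complex.ext h.symm
      rw [h3, ← h, heql, hlim]
    rcases h2.eq_or_lt with h' | h'
    · right
      apply Complex.ext h'
      rw [h3, h', heqr, hrim]
    · exact absurd ⟨h, h'⟩ hnot
  have hmono : subgraph g ⊆ subgraph g' := fun z h => ⟨h.1, h.2.1, h.2.2.1, h.2.2.2.trans (hle _)⟩
  have hgraph' : graphOver g' (pt l).re (pt r).re ⊆ subgraph g' := by
    rintro z ⟨h1, h2, h3⟩
    exact ⟨hl01.1.trans h1, h2.trans hr01.2.1, h3 ▸ (H.nonneg _).trans (hle _), h3.le⟩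
  have husnot : ∀ v ∈ us, pt' v ∉ subgraph g := by
    intro v hv h
    have h4 := h.2.2.2
    rw [hpt_us v hv] at h4
    exact absurd h4 (hlt _ (hξ v hv)).not_ge
  have hltop : l ∈ l :: (us ++ [r]) := by simp
  have hrtop : r ∈ l :: (us ++ [r]) := by simp
  -- the new face
  set R := openBetween g g' (pt l).re (pt r).re with hR
  have hRdisj : ∀ z ∈ R, z ∉ subgraph g := fun z h h' => absurd h'.2.2.2 h.2.2.1.not_ge
  have hRne : R.Nonempty := by
    have hm : ((pt l).re + (pt r).re) / 2 ∈ Ioo (pt l).re (pt r).re := by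
      constructor <;> linarith
    have := hlt _ hm
    refine ⟨⟨((pt l).re + (pt r).re) / 2, (g (((pt l).re + (pt r).re) / 2) +
      g' (((pt l).re + (pt r).re) / 2)) / 2⟩, hm.1, hm.2, ?_, ?_⟩
    · simp only; linarith
    · simp only; linarith
  have hFsub : ∀ F ∈ 𝓕, F ⊆ subgraph g := by
    intro F hF
    have : F ⊆ ⋃₀ 𝓕 := subset_sUnion_of_mem hF
    rw [H.sUnion_faces] at this
    exact this.trans sdiff_subset
  have hRF : ∀ F ∈ 𝓕, Disjoint R F := fun F hF =>
    disjoint_left.2 fun z hz hz' => hRdisj z hz (hFsub F hF hz')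
  have hcov : covered (S ∪ {v | v ∈ us}) (E ∪ N) pt' arc' =
      covered S E pt arc ∪ graphOver g' (pt l).re (pt r).re := by
    have h1 : pt' '' S = pt '' S := image_congr fun v hv => hpt_S v hv
    have h2 : ⋃ e ∈ E, arc' e = ⋃ e ∈ E, arc e := iUnion₂_congr harc_E
    have h3 : pt' '' {v | v ∈ us} ⊆ graphOver g' (pt l).re (pt r).re := by
      rintro _ ⟨v, hv, rfl⟩
      rw [hpt_us v hv]
      exact ⟨(hξ v hv).1.le, (hξ v hv).2.le, rfl⟩
    simp only [covered, image_union, biUnion_union, h1, h2, hU']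
    ext z
    have := @h3 z
    simp only [mem_union]
    tauto
  have hcovsub : covered S E pt arc ⊆ subgraph g := by
    rintro z (⟨v, hv, rfl⟩ | hz)
    · exact H.pt_mem v hv
    · obtain ⟨e, he, hz⟩ := mem_iUnion₂.1 hz
      exact H.arc_subset e he hz
  have hPQ : pathEdges (P ++ l :: (us ++ r :: Q)) =
      pathEdges (P ++ [l]) ∪ N ∪ pathEdges (r :: Q) := by
    have := pathEdges_append r Q (l :: us)
    simp only [List.cons_append] at this
    rw [pathEdges_append, this, union_assoc]
  have hPQ0 : pathEdges (P ++ l :: (M ++ r :: Q)) =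
      pathEdges (P ++ [l]) ∪ pathEdges (l :: (M ++ [r])) ∪ pathEdges (r :: Q) := by
    have := pathEdges_append r Q (l :: M)
    simp only [List.cons_append] at this
    rw [pathEdges_append, this, union_assoc]
  have hMpath : IsGraphPath (fun v => (pt v).re) arc g (l :: (M ++ [r])) := by
    have h1 := H.top_path.of_append_right
    rw [← List.cons_append] at h1
    exact h1.of_append_left
  refine ⟨R, pt', arc', g', fun h => ?_, ?_⟩
  · obtain ⟨z, hz⟩ := hRne
    exact hRdisj z hz (hFsub R h hz)
  constructor
  case continuous => exact hg'c
  case nonneg => exact fun x => (H.nonneg x).trans (hle x)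
  case outside =>
    intro x hx
    rw [heq x fun h => hx ⟨hl01.1.trans_lt h.1, h.2.trans_le hr01.2.1⟩, H.outside x hx]
  case finite => exact H.finite.union us.finite_toSet
  case ends_mem =>
    rintro e (he | he) v hv
    · exact Or.inl (H.ends_mem e he v hv)
    · have := mem_of_mem_pathEdges he hv
      simp only [List.mem_cons, List.mem_append, List.not_mem_nil, or_false] at this
      rcases this with rfl | h | rfl
      · exact Or.inl hlS
      · exact Or.inr h
      · exact Or.inl hrS
  case injOn =>
    rintro u (hu | hu) v (hv | hv) huv
    · rw [hpt_S u hu, hpt_S v hv] at huv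
      exact H.injOn hu hv huv
    · rw [hpt_S u hu] at huv
      exact absurd (huv ▸ H.pt_mem u hu) (husnot v hv)
    · rw [hpt_S v hv] at huv
      exact absurd (huv ▸ H.pt_mem v hv) (husnot u hu)
    · exact hpath.eq_of_eq (List.mem_cons_of_mem _ (List.mem_append_left _ hu))
        (List.mem_cons_of_mem _ (List.mem_append_left _ hv)) (congrArg Complex.re huv)
  case pt_mem =>
    rintro v (hv | hv)
    · rw [hpt_S v hv]; exact hmono (H.pt_mem v hv)
    · rw [hpt_us v hv]; exact hgraph' ⟨(hξ v hv).1.le, (hξ v hv).2.le, rfl⟩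
  case arc_subset =>
    rintro e (he | he)
    · rw [harc_E e he]; exact (H.arc_subset e he).trans hmono
    · exact (hNsub e he).trans hgraph'
  case isSimpleArc =>
    rintro u v (he | he)
    · rw [harc_E _ he, hpt_S u (H.ends_mem _ he u (Sym2.mem_mk_left _ _)),
        hpt_S v (H.ends_mem _ he v (Sym2.mem_mk_right _ _))]
      exact H.isSimpleArc u v he
    · obtain ⟨u', v', he', hu, hv, huv, ha, -⟩ := hpath.exists_ends he
      have := isSimpleArc_graphOver hg'c huv
      have hpt : ∀ w ∈ l :: (us ++ [r]), (⟨x' w, g' (x' w)⟩ : ℂ) = pt' w := fun w hw =>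
        Complex.ext rfl (hNim w hw).symm
      rw [hpt u' hu, hpt v' hv] at this
      rw [ha]
      rcases Sym2.eq_iff.1 he' with ⟨rfl, rfl⟩ | ⟨rfl, rfl⟩
      · exact this
      · exact this.symm
  case mem_of_mem_arc =>
    rintro e (he | he) v (hv | hv) h
    · rw [harc_E e he, hpt_S v hv] at h
      exact H.mem_of_mem_arc e he v hv h
    · rw [harc_E e he] at h
      exact absurd (H.arc_subset e he h) (husnot v hv)
    · have hv' := hmeet (pt' v) (by rw [hpt_S v hv]; exact H.pt_mem v hv) (hNsub e he h)
      rw [hpt_S v hv] at hv'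
      rcases hv' with hv' | hv'
      · have := H.injOn hv hlS hv'
        subst this
        exact hpath.mem_of_re_eq he hltop h rfl
      · have := H.injOn hv hrS hv'
        subst this
        exact hpath.mem_of_re_eq he hrtop h rfl
    · exact hpath.mem_of_re_eq he (List.mem_cons_of_mem _ (List.mem_append_left _ hv)) h rfl
  case arc_inter_arc =>
    have key : ∀ e ∈ E, ∀ f ∈ N, ∀ z, z ∈ arc' e → z ∈ arc' f →
        ∃ v, v ∈ e ∧ v ∈ f ∧ z = pt' v := by
      intro e he f hf z hze hzf
      rw [harc_E e he] at hze
      rcases hmeet z (H.arc_subset e he hze) (hNsub f hf hzf) with rfl | rfl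
      · exact ⟨l, H.mem_of_mem_arc e he l hlS hze,
          hpath.mem_of_re_eq hf hltop hzf hx'l.symm, (hpt_S l hlS).symm⟩
      · exact ⟨r, H.mem_of_mem_arc e he r hrS hze,
          hpath.mem_of_re_eq hf hrtop hzf hx'r.symm, (hpt_S r hrS).symm⟩
    rintro e (he | he) f (hf | hf) hef z ⟨hze, hzf⟩
    · rw [harc_E e he] at hze
      rw [harc_E f hf] at hzf
      obtain ⟨v, h1, h2, h3⟩ := H.arc_inter_arc e he f hf hef z ⟨hze, hzf⟩
      exact ⟨v, h1, h2, by rw [h3, hpt_S v (H.ends_mem e he v h1)]⟩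
    · exact key e he f hf z hze hzf
    · obtain ⟨v, h1, h2, h3⟩ := key f hf e he z hzf hze
      exact ⟨v, h2, h1, h3⟩
    · obtain ⟨v, hv, h1, h2, h3⟩ := hpath.exists_of_mem_inter he hf hef hze hzf
      refine ⟨v, h1, h2, Complex.ext h3 ?_⟩
      rw [hNim v hv, (hNsub e he hze).2.2, h3]
  case top_mem =>
    intro v hv
    simp only [List.mem_cons, List.mem_append] at hv
    rcases hv with h | rfl | h | rfl | h
    · exact Or.inl (H.top_mem v (by simp [h]))
    · exact Or.inl hlS
    · exact Or.inr h
    · exact Or.inl hrS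
    · exact Or.inl (H.top_mem v (by simp [h]))
  case top_edges =>
    have := H.top_edges
    rw [hPQ0] at this
    rw [hPQ]
    rintro e ((he | he) | he)
    · exact Or.inl (this (Or.inl (Or.inl he)))
    · exact Or.inr he
    · exact Or.inl (this (Or.inr he))
  case top_im =>
    intro v hv
    have hold : v ∈ P ++ l :: (M ++ r :: Q) → v ∈ S → (pt v).re ∉ Ioo (pt l).re (pt r).re →
        (pt' v).im = g' (pt' v).re := by
      intro h1 h2 h3
      rw [hpt_S v h2, heq _ h3]
      exact H.top_im v h1
    have hmem : ∀ v, v ∈ P ++ l :: (M ++ r :: Q) → v ∈ S := H.top_mem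
    simp only [List.mem_cons, List.mem_append] at hv
    rcases hv with h | rfl | h | rfl | h
    · have hm : v ∈ P ++ l :: (M ++ r :: Q) := by simp [h]
      exact hold hm (hmem v hm) fun h' => lt_asymm h'.1 (hPx v h l (Or.inl rfl))
    · exact hNim _ (by simp)
    · exact hNim _ (by simp [h])
    · exact hNim _ (by simp)
    · have hm : v ∈ P ++ l :: (M ++ r :: Q) := by simp [h]
      exact hold hm (hmem v hm) fun h' => lt_asymm h'.2 (hrQ v h)
  case top_path =>
    have hx' : ∀ v ∈ P ++ l :: (M ++ r :: Q), x' v = (pt v).re := fun v hv => by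
      simp only [x', hpt_S v (H.top_mem v hv)]
    have htE : ∀ e ∈ pathEdges (P ++ l :: (M ++ r :: Q)), arc' e = arc e :=
      fun e he => harc_E e (H.top_edges he)
    have h1 : IsGraphPath x' arc' g' (P ++ [l]) := by
      refine H.top_path.of_append_left.congr (fun v hv => hx' v ?_) (fun e he => htE e ?_)
        (a := 0) (b := (pt l).re) ?_ fun t _ ht => heq t fun h => h.1.not_ge ht
      · simp only [List.mem_append, List.mem_singleton] at hv
        rcases hv with h | rfl <;> simp [*]
      · rw [hPQ0]; exact Or.inl (Or.inl he)
      · intro v hv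
        have hvS : v ∈ S := H.top_mem v (by
          simp only [List.mem_append, List.mem_singleton] at hv
          rcases hv with h | rfl <;> simp [*])
        refine ⟨(H.pt_mem v hvS).1, ?_⟩
        simp only [List.mem_append, List.mem_singleton] at hv
        rcases hv with h | rfl
        · exact (hPx v h l (Or.inl rfl)).le
        · exact le_rfl
    have h2 : IsGraphPath x' arc' g' (r :: Q) := by
      have h0 := H.top_path.of_append_right
      rw [← List.cons_append] at h0
      refine h0.of_append_right.congr (fun v hv => hx' v ?_) (fun e he => htE e ?_)
        (a := (pt r).re) (b := 1) ?_ fun t ht _ => heq t fun h => h.2.not_ge ht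
      · rcases List.mem_cons.1 hv with rfl | h <;> simp [*]
      · rw [hPQ0]; exact Or.inr he
      · intro v hv
        have hvS : v ∈ S := H.top_mem v (by
          rcases List.mem_cons.1 hv with rfl | h <;> simp [*])
        refine ⟨?_, (H.pt_mem v hvS).2.1⟩
        rcases List.mem_cons.1 hv with rfl | h
        · exact le_rfl
        · exact (hrQ v h).le
    have h3 := IsGraphPath.append (P := l :: us) hpath h2
    rw [List.cons_append] at h3
    exact h1.append h3
  case top_head =>
    intro v hv
    have hv' : (P ++ l :: (M ++ r :: Q)).head? = some v := by simpa using hv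
    rw [hpt_S v (H.top_mem v (List.mem_of_head? hv'))]
    exact H.top_head v hv'
  case top_last =>
    intro v hv
    have hv' : (P ++ l :: (M ++ r :: Q)).getLast? = some v := by
      simpa [List.getLast?_append, List.getLast?_cons] using hv
    rw [hpt_S v (H.top_mem v (List.mem_of_getLast? hv'))]
    exact H.top_last v hv'
  case bottom_mem => exact fun v hv => Or.inl (H.bottom_mem v hv)
  case bottom_edges => exact H.bottom_edges.trans subset_union_left
  case bottom_arc =>
    rw [iUnion₂_congr fun e he => harc_E e (H.bottom_edges he)]
    exact H.bottom_arc
  case isOpen_face =>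
    rintro F (rfl | hF)
    · exact isOpen_openBetween hgc hg'c _ _
    · exact H.isOpen_face F hF
  case isPreconnected_face =>
    rintro F (rfl | hF)
    · exact isPreconnected_openBetween hgc hg'c hlt
    · exact H.isPreconnected_face F hF
  case nonempty_face =>
    rintro F (rfl | hF)
    · exact hRne
    · exact H.nonempty_face F hF
  case disjoint_faces =>
    exact H.disjoint_faces.insert fun F hF _ => hRF F hF
  case sUnion_faces =>
    rw [sUnion_insert, H.sUnion_faces, hcov]
    ext z
    constructor
    · rintro (hz | ⟨h1, h2⟩)
      · refine ⟨⟨hl01.1.trans hz.1.le, hz.2.1.le.trans hr01.2.1,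
          (H.nonneg _).trans hz.2.2.1.le, hz.2.2.2.le⟩, ?_⟩
        rintro (h | h)
        · exact hRdisj z hz (hcovsub h)
        · exact hz.2.2.2.ne h.2.2
      · refine ⟨hmono h1, ?_⟩
        rintro (h | h)
        · exact h2 h
        · rcases hmeet z h1 h with rfl | rfl
          · exact h2 (Or.inl ⟨l, hlS, rfl⟩)
          · exact h2 (Or.inl ⟨r, hrS, rfl⟩)
    -- A point above the graph of `g` but not above that of `g'` sits under the bump: it is in `R`
    -- or on the ear.
    · rintro ⟨h1, h2⟩
      by_cases hz : z.im ≤ g z.re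
      · exact Or.inr ⟨⟨h1.1, h1.2.1, h1.2.2.1, hz⟩, fun h => h2 (Or.inl h)⟩
      · left
        have hio : z.re ∈ Ioo (pt l).re (pt r).re := by
          by_contra h
          exact hz (heq _ h ▸ h1.2.2.2)
        refine ⟨hio.1, hio.2, not_le.1 hz, lt_of_le_of_ne h1.2.2.2 fun h => ?_⟩
        exact h2 (Or.inr ⟨hio.1.le, hio.2.le, h⟩)
  case isPolygon_face =>
    rintro F (rfl | hF)
    -- The pentagon runs along the replaced part of the boundary from `l` to `r` and back along the
    -- ear, hence the reversal.
    · have hcyc : pathEdges (l :: (M ++ r :: us.reverse) ++ [l]) =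
          pathEdges (l :: (M ++ [r])) ∪ N := by
        have h1 := pathEdges_append r (us.reverse ++ [l]) (l :: M)
        have h2 := pathEdges_reverse (l :: (us ++ [r]))
        simp only [List.reverse_cons, List.reverse_append, List.reverse_nil, List.nil_append,
          List.cons_append, List.append_assoc] at h1 h2 ⊢
        rw [h1, hN, ← h2]
      have hMnd : (l :: (M ++ [r])).Nodup :=
        hMpath.pairwise.imp fun h h' => h.ne (by rw [h'])
      have hMS : ∀ v ∈ l :: (M ++ [r]), v ∈ S := by
        intro v hv
        apply H.top_mem
        simp only [List.mem_cons, List.mem_append, List.not_mem_nil, or_false] at hv ⊢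
        tauto
      refine ⟨l, M ++ r :: us.reverse, ?_, by simp; omega, ?_, ?_, ?_⟩
      · have : l :: (M ++ r :: us.reverse) = l :: (M ++ [r]) ++ us.reverse := by simp
        rw [this, List.nodup_append]
        refine ⟨hMnd, List.nodup_reverse.2 hus, ?_⟩
        rintro a ha b hb rfl
        exact hS a (List.mem_reverse.1 hb) (hMS a ha)
      · intro v hv
        simp only [List.mem_cons, List.mem_append, List.mem_reverse] at hv
        by_cases hvu : v ∈ us
        · exact Or.inr hvu
        · refine Or.inl (hMS v ?_)
          simp only [List.mem_cons, List.mem_append, List.not_mem_nil, or_false]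
          tauto
      · rw [hcyc]
        refine union_subset_union_left _ (Subset.trans ?_ H.top_edges)
        rw [hPQ0]
        exact fun e he => Or.inl (Or.inr he)
      · have h1 : ⋃ e ∈ pathEdges (l :: (M ++ [r])), arc' e =
            graphOver g (pt l).re (pt r).re := by
          rw [← hMpath.iUnion_arc]
          refine iUnion₂_congr fun e he => harc_E e (H.top_edges ?_)
          rw [hPQ0]
          exact Or.inl (Or.inr he)
        rw [hcyc, biUnion_union, h1, hU', hR,
          frontier_openBetween hgc hg'c hlr hlt heql.symm heqr.symm]
    · obtain ⟨a, t, h1, h2, h3, h4, h5⟩ := H.isPolygon_face F hF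
      refine ⟨a, t, h1, h2, fun v hv => Or.inl (h3 v hv), h4.trans subset_union_left, ?_⟩
      rw [h5]
      exact iUnion₂_congr fun e he => (harc_E e (h4 he)).symm

end Ear

/-! ### From a layered drawing to a pentagulation -/

section Layered

open Set

variable {V : Type}

/-- There is a layered drawing with exactly `p` bounded faces. -/
def Layered (B top : List V) (S : Set V) (E : Set (Sym2 V)) (p : ℕ) : Prop :=
  ∃ (𝓕 : Set (Set ℂ)) (pt : V → ℂ) (arc : Sym2 V → Set ℂ) (g : ℝ → ℝ), 𝓕.encard = (p : ℕ∞) ∧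
    IsLayered B top S E 𝓕 pt arc g

theorem layered_base {s t : V} {m : List V} (hnd : (s :: (m ++ [t])).Nodup) :
    Layered (s :: (m ++ [t])) (s :: (m ++ [t])) {v | v ∈ s :: (m ++ [t])}
      (pathEdges (s :: (m ++ [t]))) 0 := by
  obtain ⟨pt, arc, g, h⟩ := isLayered_base hnd
  exact ⟨∅, pt, arc, g, by simp, h⟩

/-- Adding a path above the upper boundary so that a pentagon arises. -/
theorem Layered.ear {B P Q : List V} {S : Set V} {E : Set (Sym2 V)} {p : ℕ} {l : V} (M : List V)
    {r : V} (us : List V) (H : Layered B (P ++ l :: (M ++ r :: Q)) S E p) (hus : us.Nodup)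
    (hS : ∀ u ∈ us, u ∉ S) (hE : ∀ e ∈ pathEdges (l :: (us ++ [r])), e ∉ E)
    (hlen : M.length + us.length = 3) :
    Layered B (P ++ l :: (us ++ r :: Q)) (S ∪ {v | v ∈ us})
      (E ∪ pathEdges (l :: (us ++ [r]))) (p + 1) := by
  obtain ⟨𝓕, pt, arc, g, hp, h⟩ := H
  obtain ⟨R, pt', arc', g', hR, h'⟩ := h.ear hus hS hE hlen
  exact ⟨insert R 𝓕, pt', arc', g', by rw [encard_insert_of_notMem hR, hp]; rfl, h'⟩

theorem Layered.ends_mem {B top : List V} {S : Set V} {E : Set (Sym2 V)} {p : ℕ}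
    (H : Layered B top S E p) : ∀ e ∈ E, ∀ v ∈ e, v ∈ S := by
  obtain ⟨𝓕, pt, arc, g, -, h⟩ := H
  exact h.ends_mem

theorem Layered.finite {B top : List V} {S : Set V} {E : Set (Sym2 V)} {p : ℕ}
    (H : Layered B top S E p) : S.Finite := by
  obtain ⟨𝓕, pt, arc, g, -, h⟩ := H
  exact h.finite

theorem Layered.ne_of_mem {B top : List V} {S : Set V} {E : Set (Sym2 V)} {p : ℕ}
    (H : Layered B top S E p) {u v : V} (h : s(u, v) ∈ E) : u ≠ v := by
  obtain ⟨𝓕, pt, arc, g, -, h'⟩ := H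
  obtain ⟨γ, -, h2, h3, h4, -⟩ := h'.isSimpleArc u v h
  rintro rfl
  exact zero_ne_one (h2 (h3.trans h4.symm))

/-- The graph with vertices `S` and edges `E`. -/
def graphWith (S : Set V) (E : Set (Sym2 V)) : SimpleGraph S :=
  (SimpleGraph.fromEdgeSet E).comap Subtype.val

theorem graphWith_adj {S : Set V} {E : Set (Sym2 V)} {u v : S} :
    (graphWith S E).Adj u v ↔ s(u.1, v.1) ∈ E ∧ u.1 ≠ v.1 := by
  simp [graphWith]

/-- A layered drawing whose upper boundary is a single edge is a pentagulation. -/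
theorem Layered.exists_isPentagulation {s t : V} {m : List V} {S : Set V} {E : Set (Sym2 V)}
    {p : ℕ} (H : Layered (s :: (m ++ [t])) [s, t] S E p) (hnd : (s :: (m ++ [t])).Nodup)
    (hm : m ≠ []) (hconn : (graphWith S E).Connected) :
    ∃ D : PlaneDrawing (graphWith S E), D.IsPentagulation (m.length + 2) p := by
  have hadj : ∀ u v : S, (graphWith S E).Adj u v ↔ s(u.1, v.1) ∈ E := fun u v => by
    rw [graphWith_adj]
    exact ⟨fun h => h.1, fun h => ⟨h, H.ne_of_mem h⟩⟩
  have hedge : ∀ e : Sym2 S, e ∈ (graphWith S E).edgeSet ↔ e.map Subtype.val ∈ E := by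
    intro e
    induction e with
    | _ u v => exact hadj u v
  have hmem : ∀ (v : S) (e : Sym2 S), v.1 ∈ e.map Subtype.val ↔ v ∈ e := by
    intro v e
    induction e with
    | _ a b => simp [Subtype.ext_iff]
  obtain ⟨𝓕, pt, arc, g, hp, h⟩ := H
  let D : PlaneDrawing (graphWith S E) :=
    { point := fun v => pt v.1
      arc := fun e => arc (e.map Subtype.val)
      point_injective := fun u v huv => Subtype.ext (h.injOn u.2 v.2 huv)
      arc_spec := fun u v huv => h.isSimpleArc u.1 v.1 ((hadj u v).1 huv)
      mem_of_point_mem_arc := fun e he v hv =>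
        (hmem v e).1 (h.mem_of_mem_arc _ ((hedge e).1 he) v.1 v.2 hv)
      arc_inter_arc := fun e he f hf hef z hz => by
        obtain ⟨v, h1, h2, h3⟩ := h.arc_inter_arc _ ((hedge e).1 he) _ ((hedge f).1 hf)
          (fun h => hef (Sym2.map.injective Subtype.val_injective h)) z hz
        have hv : v ∈ S := h.ends_mem _ ((hedge e).1 he) v h1
        exact ⟨⟨v, hv⟩, (hmem ⟨v, hv⟩ e).1 h1, (hmem ⟨v, hv⟩ f).1 h2, h3⟩ }
  have hlift : ∀ e ∈ E, ∃ e' ∈ (graphWith S E).edgeSet, e'.map Subtype.val = e := by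
    intro e he
    induction e with
    | _ u v =>
      have hu := h.ends_mem _ he u (Sym2.mem_mk_left _ _)
      have hv := h.ends_mem _ he v (Sym2.mem_mk_right _ _)
      exact ⟨s(⟨u, hu⟩, ⟨v, hv⟩), (hedge _).2 he, rfl⟩
  have hsupp : D.support = covered S E pt arc := by
    unfold PlaneDrawing.support covered
    congr 1
    · ext z; simp [D]
    · ext z
      simp only [mem_iUnion]
      constructor
      · rintro ⟨e, he, hz⟩
        exact ⟨_, (hedge e).1 he, hz⟩
      · rintro ⟨e, he, hz⟩
        obtain ⟨e', he', rfl⟩ := hlift e he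
        exact ⟨e', he', hz⟩
  have hpoly : ∀ (k : ℕ) (F : Set ℂ), 3 ≤ k → IsPolygon S E arc k F → D.IsPolygonalFace k F := by
    rintro k F hk ⟨a, t, h1, h2, h3, h4, h5⟩
    obtain ⟨a, rfl⟩ : ∃ a' : S, a'.1 = a := ⟨⟨a, h3 a (by simp)⟩, rfl⟩
    obtain ⟨t, rfl⟩ : ∃ t' : List S, t'.map Subtype.val = t :=
      ⟨t.attachWith (· ∈ S) fun v hv => h3 v (by simp [hv]), by simp⟩
    have hmap : a.1 :: t.map Subtype.val ++ [a.1] = (a :: t ++ [a]).map Subtype.val := by simp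
    rw [hmap, pathEdges_map] at h4 h5
    rw [← List.map_cons, List.nodup_map_iff Subtype.val_injective] at h1
    rw [List.length_map] at h2
    obtain ⟨v, c, hc1, hc2, hc3⟩ := exists_isCycle_of_pathEdges (G := graphWith S E) h1 (by omega)
      fun e he => (hedge e).2 (h4 ⟨e, he, rfl⟩)
    exact ⟨v, c, hc1, hc2.trans h2, by rw [hc3, h5, biUnion_image]⟩
  have hsub : covered S E pt arc ⊆ subgraph g := by
    rintro z (⟨v, hv, rfl⟩ | hz)
    · exact h.pt_mem v hv
    · obtain ⟨e, he, hz⟩ := mem_iUnion₂.1 hz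
      exact h.arc_subset e he hz
  have hFsub : ∀ F ∈ 𝓕, F ⊆ subgraph g := by
    intro F hF
    have : F ⊆ ⋃₀ 𝓕 := subset_sUnion_of_mem hF
    rw [h.sUnion_faces] at this
    exact this.trans sdiff_subset
  have hfaces : D.faces = insert (subgraph g)ᶜ 𝓕 := by
    unfold PlaneDrawing.faces
    rw [hsupp]
    apply components_eq
    · rw [sUnion_insert, h.sUnion_faces]
      ext z
      have := @hsub z
      simp only [mem_compl_iff, mem_union, mem_sdiff]
      tauto
    · rintro F (rfl | hF)
      · exact (isClosed_subgraph h.continuous).isOpen_compl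
      · exact h.isOpen_face F hF
    · rintro F (rfl | hF)
      · exact isPreconnected_compl_subgraph h.continuous h.outside
      · exact h.isPreconnected_face F hF
    · rintro F (rfl | hF)
      · exact ⟨⟨-1, 0⟩, fun h => by have := h.1; norm_num at this⟩
      · exact h.nonempty_face F hF
    · refine h.disjoint_faces.insert fun F hF _ => ?_
      exact disjoint_compl_left_iff_subset.2 (hFsub F hF)
  have hnot : (subgraph g)ᶜ ∉ 𝓕 := by
    intro hF
    obtain ⟨z, hz⟩ := h.nonempty_face _ hF
    exact hz (hFsub _ hF hz)
  have hdiff : D.faces \ {(subgraph g)ᶜ} = 𝓕 := by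
    rw [hfaces, insert_sdiff_of_mem _ (mem_singleton _), sdiff_singleton_eq_self hnot]
  refine ⟨D, hconn, (subgraph g)ᶜ, hfaces ▸ mem_insert _ _, ?_, ?_, ?_⟩
  · apply hpoly
    · have := List.length_pos_iff.2 hm
      omega
    -- The single edge left on top closes the bottom path to the `n`-cycle. The two are drawn on the
    -- graphs of `g` and `0`, which form the frontier of the outside.
    have hcyc : pathEdges (s :: (m ++ [t]) ++ [s]) =
        pathEdges (s :: (m ++ [t])) ∪ pathEdges [s, t] := by
      have := pathEdges_append t [s] (s :: m)
      simp only [List.cons_append, List.append_assoc, List.nil_append] at this ⊢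
      rw [this]
      simp [Sym2.eq_swap]
    refine ⟨s, m ++ [t], hnd, by simp, h.bottom_mem, ?_, ?_⟩
    · rw [hcyc]; exact union_subset h.bottom_edges h.top_edges
    · have htop := IsGraphPath.iUnion_arc (t := []) h.top_path
      rw [h.top_head s rfl, h.top_last t rfl] at htop
      rw [hcyc, biUnion_union, h.bottom_arc, frontier_compl_subgraph h.continuous h.nonneg h.outside]
      exact congrArg _ htop.symm
  · rw [hdiff]
    exact fun F hF => hpoly 5 F (by norm_num) (h.isPolygon_face F hF)
  · rw [hdiff, hp]

end Layered

/-! ### Three-connectedness of a ring with two sides -/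

section Connectivity

variable {V : Type}

/-- `u` and `v` are joined by a path of `G` that avoids `X`. -/
def JoinedOff (G : SimpleGraph V) (X : Set V) (u v : V) : Prop :=
  ∃ (hu : u ∈ Xᶜ) (hv : v ∈ Xᶜ), (G.induce Xᶜ).Reachable ⟨u, hu⟩ ⟨v, hv⟩

namespace JoinedOff

variable {G : SimpleGraph V} {X : Set V} {u v w : V}

theorem refl (hu : u ∉ X) : JoinedOff G X u u := ⟨hu, hu, .rfl⟩

theorem of_adj (hu : u ∉ X) (hv : v ∉ X) (h : G.Adj u v) : JoinedOff G X u v :=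
  ⟨hu, hv, SimpleGraph.Adj.reachable (by simpa using h)⟩

theorem symm (h : JoinedOff G X u v) : JoinedOff G X v u := by
  obtain ⟨hu, hv, h⟩ := h
  exact ⟨hv, hu, h.symm⟩

theorem trans (h : JoinedOff G X u v) (h' : JoinedOff G X v w) : JoinedOff G X u w := by
  obtain ⟨hu, hv, h⟩ := h
  obtain ⟨_, hw, h'⟩ := h'
  exact ⟨hu, hw, h.trans h'⟩

theorem of_path {d : ℕ → V} (k : ℕ) (hadj : ∀ i < k, G.Adj (d i) (d (i + 1)))
    (hX : ∀ i ≤ k, d i ∉ X) : JoinedOff G X (d 0) (d k) := by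
  induction k with
  | zero => exact refl (hX 0 le_rfl)
  | succ k ih =>
    exact (ih (fun i hi => hadj i (by omega)) (fun i hi => hX i (by omega))).trans
      (of_adj (hX k (by omega)) (hX (k + 1) le_rfl) (hadj k (by omega)))

end JoinedOff

/-- The closed walk `d` of length `n` is joined by spokes to the vertices of the ring `r` whose
indices have the parity of `ε`. -/
structure IsSide (G : SimpleGraph V) (n : ℕ) (r d : ℕ → V) (ε : ℕ) : Prop where
  adj : ∀ i, G.Adj (d i) (d (i + 1))
  spoke : ∀ i, G.Adj (d i) (r (2 * i + ε))
  add_period : ∀ i, d (i + n) = d i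
  ne : ∀ i, d i ≠ d (i + 2)
  ne_ring : ∀ i j, d i ≠ r j

/-- `r` runs around a cycle of length `2 * n`. -/
structure IsRing (G : SimpleGraph V) (n : ℕ) (r : ℕ → V) : Prop where
  adj : ∀ i, G.Adj (r i) (r (i + 1))
  eq_iff : ∀ i j, r i = r j ↔ i ≡ j [MOD 2 * n]

theorem three_le_ncard [Finite V] {X : Set V} {x y z : V} (hx : x ∈ X) (hy : y ∈ X) (hz : z ∈ X)
    (hxy : x ≠ y) (hxz : x ≠ z) (hyz : y ≠ z) : 3 ≤ X.ncard :=
  (Set.two_lt_ncard_iff X.toFinite).2 ⟨x, y, z, hx, hy, hz, hxy, hxz, hyz⟩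

theorem IsRing.ne_of_lt {G : SimpleGraph V} {n : ℕ} {r : ℕ → V} (h : IsRing G n r) {i j : ℕ}
    (hij : i < j) (hj : j < i + 2 * n) : r i ≠ r j := by
  rw [Ne, h.eq_iff]
  intro h'
  have := (Nat.modEq_iff_dvd' hij.le).1 h'
  have := Nat.le_of_dvd (by omega) this
  omega

/-- If the spoke at `d i` is lost, its end is the one deleted ring vertex. The neighbours of `d i`
along the closed walk are distinct and at most one more vertex is deleted, so one of them survives;
its spoke ends elsewhere on the ring. The walk may repeat vertices: only those two steps apart have
to differ. -/
theorem IsSide.joinedOff_of_unique [Finite V] {G : SimpleGraph V} {n : ℕ} (hn : 3 ≤ n)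
    {r d : ℕ → V} {ε : ℕ} (hr : IsRing G n r) (hd : IsSide G n r d ε) {X : Set V}
    (hX : X.ncard < 3) {j : ℕ} (hj : r j ∈ X) (huniq : ∀ i, r i ∈ X → r i = r j) {h : V}
    (hring : ∀ i, r i ∉ X → JoinedOff G X (r i) h) {i : ℕ} (hi : d i ∉ X) :
    JoinedOff G X (d i) h := by
  by_cases hs : r (2 * i + ε) ∈ X
  · obtain ⟨i, rfl⟩ | rfl : (∃ k, i = k + 1) ∨ i = 0 := by
      rcases i with _ | k
      · exact Or.inr rfl
      · exact Or.inl ⟨k, rfl⟩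
    · by_cases h0 : d i ∈ X
      · by_cases h2 : d (i + 2) ∈ X
        · have := three_le_ncard hj h0 h2 (hd.ne_ring _ _).symm (hd.ne_ring _ _).symm (hd.ne i)
          omega
        · have hs' : r (2 * (i + 2) + ε) ∉ X := fun hs' =>
            hr.ne_of_lt (i := 2 * (i + 1) + ε) (j := 2 * (i + 2) + ε) (by omega) (by omega)
              ((huniq _ hs).trans (huniq _ hs').symm)
          exact ((JoinedOff.of_adj hi h2 (hd.adj (i + 1))).trans
            (.of_adj h2 hs' (hd.spoke _))).trans (hring _ hs')
      · have hs' : r (2 * i + ε) ∉ X := fun hs' =>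
          hr.ne_of_lt (i := 2 * i + ε) (j := 2 * (i + 1) + ε) (by omega) (by omega)
            ((huniq _ hs').trans (huniq _ hs).symm)
        exact ((JoinedOff.of_adj h0 hi (hd.adj i)).symm.trans
          (.of_adj h0 hs' (hd.spoke _))).trans (hring _ hs')
    -- At index `0` the predecessor on the closed walk has index `n - 1`.
    · have hn1 : n - 1 + 1 = 0 + n := by omega
      have hdn : d (n - 1 + 1) = d 0 := by rw [hn1]; exact hd.add_period 0
      have hd1 : d (n - 1 + 2) = d 1 := by
        rw [show n - 1 + 2 = 1 + n by omega]; exact hd.add_period 1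
      by_cases h0 : d (n - 1) ∈ X
      · by_cases h2 : d 1 ∈ X
        · have := three_le_ncard hj h0 h2 (hd.ne_ring _ _).symm (hd.ne_ring _ _).symm
            (hd1 ▸ hd.ne (n - 1))
          omega
        · have hs' : r (2 * 1 + ε) ∉ X := fun hs' =>
            hr.ne_of_lt (i := 2 * 0 + ε) (j := 2 * 1 + ε) (by omega) (by omega)
              ((huniq _ hs).trans (huniq _ hs').symm)
          exact ((JoinedOff.of_adj hi h2 (hd.adj 0)).trans
            (.of_adj h2 hs' (hd.spoke _))).trans (hring _ hs')
      · have hs' : r (2 * (n - 1) + ε) ∉ X := fun hs' =>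
          hr.ne_of_lt (i := 2 * 0 + ε) (j := 2 * (n - 1) + ε) (by omega) (by omega)
            ((huniq _ hs).trans (huniq _ hs').symm)
        exact ((JoinedOff.of_adj h0 hi (hdn ▸ hd.adj (n - 1))).symm.trans
          (.of_adj h0 hs' (hd.spoke _))).trans (hring _ hs')
  · exact (JoinedOff.of_adj hi hs (hd.spoke i)).trans (hring _ hs)

/-- A ring with an outer and an inner closed walk joined to it by alternating spokes is
3-connected. -/
theorem isKConnected_three [Finite V] {G : SimpleGraph V} {n : ℕ} (hn : 3 ≤ n) {r o d : ℕ → V}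
    (hr : IsRing G n r) (ho : IsSide G n r o 0) (hd : IsSide G n r d 1)
    (hcover : ∀ v, (∃ i, v = r i) ∨ (∃ i, v = o i) ∨ ∃ i, v = d i) : IsKConnected G 3 := by
  constructor
  · have h3 := three_le_ncard (X := Set.univ \ {o 0}) (x := r 0) (y := r 1) (z := r 2)
      (by simp [(ho.ne_ring 0 0).symm]) (by simp [(ho.ne_ring 0 1).symm])
      (by simp [(ho.ne_ring 0 2).symm]) (hr.ne_of_lt (by omega) (by omega))
      (hr.ne_of_lt (by omega) (by omega)) (hr.ne_of_lt (by omega) (by omega))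
    have := Set.ncard_sdiff_singleton_add_one (Set.mem_univ (o 0))
    rw [Set.ncard_univ] at this
    omega
  · intro X hX
    suffices h : ∃ h, ∀ v ∉ X, JoinedOff G X v h by
      obtain ⟨h, hh⟩ := h
      have hne : (Xᶜ).Nonempty := by
        by_contra hne
        rw [Set.not_nonempty_iff_eq_empty, Set.compl_empty_iff] at hne
        have := three_le_ncard (X := X) (x := r 0) (y := r 1) (z := r 2)
          (by simp [hne]) (by simp [hne]) (by simp [hne]) (hr.ne_of_lt (by omega) (by omega))
          (hr.ne_of_lt (by omega) (by omega)) (hr.ne_of_lt (by omega) (by omega))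
        omega
      rw [SimpleGraph.connected_iff]
      refine ⟨fun u v => ?_, hne.to_subtype⟩
      obtain ⟨_, _, h'⟩ := (hh u u.2).trans (hh v v.2).symm
      exact h'
    by_cases h0 : ∀ i, r i ∉ X
    · have hring : ∀ i, JoinedOff G X (r i) (r 0) := fun i =>
        (JoinedOff.of_path i (fun j _ => hr.adj j) (fun j _ => h0 j)).symm
      refine ⟨r 0, fun v hv => ?_⟩
      rcases hcover v with ⟨i, rfl⟩ | ⟨i, rfl⟩ | ⟨i, rfl⟩
      · exact hring i
      · exact (JoinedOff.of_adj hv (h0 _) (ho.spoke i)).trans (hring _)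
      · exact (JoinedOff.of_adj hv (h0 _) (hd.spoke i)).trans (hring _)
    push Not at h0
    obtain ⟨j, hj⟩ := h0
    by_cases huniq : ∀ i, r i ∈ X → r i = r j
    · refine ⟨r (j + 1), ?_⟩
      have hfree : ∀ k < 2 * n - 1, r (j + 1 + k) ∉ X := fun k hk hX' =>
        hr.ne_of_lt (i := j) (j := j + 1 + k) (by omega) (by omega) (huniq _ hX').symm
      have hring : ∀ i, r i ∉ X → JoinedOff G X (r i) (r (j + 1)) := by
        intro i hi
        obtain ⟨k, hk, hik⟩ : ∃ k < 2 * n, r (j + 1 + k) = r i := by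
          -- This is `i - (j + 1)` modulo `2 * n`, with `2 * n - 1` in the role of `-1`.
          refine ⟨(i + (2 * n - 1) * (j + 1)) % (2 * n), Nat.mod_lt _ (by omega), ?_⟩
          rw [hr.eq_iff]
          have h1 : j + 1 + (i + (2 * n - 1) * (j + 1)) = i + 2 * n * (j + 1) := by
            obtain ⟨m, hm⟩ : ∃ m, 2 * n = m + 1 := ⟨2 * n - 1, by omega⟩
            rw [hm]
            simp only [Nat.add_sub_cancel]
            ring
          calc j + 1 + (i + (2 * n - 1) * (j + 1)) % (2 * n)
              ≡ j + 1 + (i + (2 * n - 1) * (j + 1)) [MOD 2 * n] :=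
                Nat.ModEq.add_left _ (Nat.mod_modEq _ _)
            _ = i + 2 * n * (j + 1) := h1
            _ ≡ i [MOD 2 * n] := by simp [Nat.ModEq]
        have hk' : k < 2 * n - 1 := by
          by_contra hcon
          have : r (j + 1 + k) = r j := by
            rw [hr.eq_iff, show j + 1 + k = j + 2 * n by omega]
            simp [Nat.ModEq]
          exact hi (hik ▸ this ▸ hj)
        rw [← hik]
        exact (JoinedOff.of_path (d := fun k => r (j + 1 + k)) k (fun i _ => hr.adj _)
          (fun i hi => hfree i (by omega))).symm
      intro v hv
      rcases hcover v with ⟨i, rfl⟩ | ⟨i, rfl⟩ | ⟨i, rfl⟩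
      · exact hring i hv
      · exact ho.joinedOff_of_unique hn hr hX hj huniq hring hv
      · exact hd.joinedOff_of_unique hn hr hX hj huniq hring hv
    push Not at huniq
    obtain ⟨k, hk, hkj⟩ := huniq
    -- Two deleted ring vertices use up all of `X`, so both sides are untouched.
    have hoX : ∀ i, o i ∉ X := fun i hi => by
      have := three_le_ncard hk hj hi hkj (ho.ne_ring _ _).symm (ho.ne_ring _ _).symm
      omega
    have hdX : ∀ i, d i ∉ X := fun i hi => by
      have := three_le_ncard hk hj hi hkj (hd.ne_ring _ _).symm (hd.ne_ring _ _).symm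
      omega
    have hO : ∀ i, JoinedOff G X (o i) (o 0) := fun i =>
      (JoinedOff.of_path i (fun j _ => ho.adj j) (fun j _ => hoX j)).symm
    have hD : ∀ i, JoinedOff G X (d i) (d 0) := fun i =>
      (JoinedOff.of_path i (fun j _ => hd.adj j) (fun j _ => hdX j)).symm
    -- The pairs with `i = 0, 1, 2` are disjoint because the ring has at least six vertices; two
    -- deletions cannot hit all three.
    obtain ⟨i, hi0, hi1⟩ : ∃ i, r (2 * i) ∉ X ∧ r (2 * i + 1) ∉ X := by
      by_contra hcon
      have key : ∀ i, ∃ m, (m = 2 * i ∨ m = 2 * i + 1) ∧ r m ∈ X := by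
        intro i
        by_contra h
        exact hcon ⟨i, fun h' => h ⟨_, Or.inl rfl, h'⟩, fun h' => h ⟨_, Or.inr rfl, h'⟩⟩
      obtain ⟨a, ha, ha'⟩ := key 0
      obtain ⟨b, hb, hb'⟩ := key 1
      obtain ⟨c, hc, hc'⟩ := key 2
      have := three_le_ncard ha' hb' hc' (hr.ne_of_lt (by omega) (by omega))
        (hr.ne_of_lt (by omega) (by omega)) (hr.ne_of_lt (by omega) (by omega))
      omega
    have hOD : JoinedOff G X (d 0) (o 0) :=
      ((((hD i).symm.trans (.of_adj (hdX i) hi1 (hd.spoke i))).trans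
        (.symm (.of_adj hi0 hi1 (hr.adj _)))).trans
        (.symm (.of_adj (hoX i) hi0 (ho.spoke i)))).trans (hO i)
    refine ⟨o 0, fun v hv => ?_⟩
    rcases hcover v with ⟨i, rfl⟩ | ⟨i, rfl⟩ | ⟨i, rfl⟩
    · obtain ⟨m, rfl | rfl⟩ := Nat.even_or_odd' i
      · exact (JoinedOff.of_adj (hoX m) hv (ho.spoke m)).symm.trans (hO m)
      · exact ((JoinedOff.of_adj (hdX m) hv (hd.spoke m)).symm.trans (hD m)).trans hOD
    · exact hO i
    · exact (hD i).trans hOD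

end Connectivity

/-! ### Vertices of the construction and the first three pentagons -/

section Construction

open Set

theorem exists_mem_of_mem_pathEdges {V : Type} {r : V} {e : Sym2 V} :
    ∀ {u : V} {t : List V}, e ∈ pathEdges (u :: (t ++ [r])) → ∃ x ∈ u :: t, x ∈ e
  | u, [], h => by
    simp only [List.nil_append, pathEdges_cons_cons, pathEdges_singleton, mem_insert_iff] at h
    rcases h with rfl | h
    · exact ⟨u, by simp, Sym2.mem_mk_left _ _⟩
    · exact h.elim
  | u, a :: t, h => by
    simp only [List.cons_append, pathEdges_cons_cons, mem_insert_iff] at h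
    rcases h with rfl | h
    · exact ⟨u, by simp, Sym2.mem_mk_left _ _⟩
    · obtain ⟨x, hx, hxe⟩ := exists_mem_of_mem_pathEdges h
      exact ⟨x, List.mem_cons_of_mem _ hx, hxe⟩

/-- An ear with at least one inner vertex has a new vertex on each of its edges, so these edges are
new automatically. Only for chords is this a condition. -/
theorem Layered.ear_cons {V : Type} {B Q : List V} {S : Set V} {E : Set (Sym2 V)} {p : ℕ}
    (P : List V) {l : V} (M : List V) {r : V} (u : V) (us : List V)
    (H : Layered B (P ++ l :: (M ++ r :: Q)) S E p)
    (hus : (u :: us).Nodup) (hS : ∀ v ∈ u :: us, v ∉ S) (hlen : M.length + us.length = 2) :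
    Layered B (P ++ l :: (u :: us ++ r :: Q)) (S ∪ {v | v ∈ u :: us})
      (E ∪ pathEdges (l :: (u :: us ++ [r]))) (p + 1) := by
  refine H.ear M (u :: us) hus hS (fun e he heE => ?_) (by simp; omega)
  have : ∃ x ∈ u :: us, x ∈ e := by
    simp only [List.cons_append, pathEdges_cons_cons, mem_insert_iff] at he
    rcases he with rfl | he
    · exact ⟨u, by simp, Sym2.mem_mk_right _ _⟩
    · exact exists_mem_of_mem_pathEdges he
  obtain ⟨x, hx, hxe⟩ := this
  exact hS x hx (H.ends_mem e heE x hxe)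

theorem Layered.chord {V : Type} {B Q : List V} {S : Set V} {E : Set (Sym2 V)} {p : ℕ}
    (P : List V) {l : V} (M : List V) {r : V}
    (H : Layered B (P ++ l :: (M ++ r :: Q)) S E p)
    (hE : s(l, r) ∉ E) (hlen : M.length = 3) :
    Layered B (P ++ l :: r :: Q) S (E ∪ {s(l, r)}) (p + 1) := by
  have := H.ear M [] List.nodup_nil (by simp) (by simpa using hE) (by simpa using hlen)
  simpa using this

theorem Layered.of_top_eq {V : Type} {B top top' : List V} {S : Set V} {E : Set (Sym2 V)} {p : ℕ}
    (H : Layered B top S E p) (h : top = top') : Layered B top' S E p := h ▸ H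

theorem Layered.top_edges {V : Type} {B top : List V} {S : Set V} {E : Set (Sym2 V)} {p : ℕ}
    (H : Layered B top S E p) : pathEdges top ⊆ E := by
  obtain ⟨𝓕, pt, arc, g, -, h⟩ := H
  exact h.top_edges

theorem Layered.bottom_edges {V : Type} {B top : List V} {S : Set V} {E : Set (Sym2 V)} {p : ℕ}
    (H : Layered B top S E p) : pathEdges B ⊆ E := by
  obtain ⟨𝓕, pt, arc, g, -, h⟩ := H
  exact h.bottom_edges

/-- The vertices of the pentagulations to be constructed: `o i` on the outer cycle, `r i` on the
ring around the cactus of pentagons, whose vertices are the `c i` and the centre `w`. -/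
inductive Vert where
  | w : Vert
  | o (i : ℕ) : Vert
  | r (i : ℕ) : Vert
  | c (i : ℕ) : Vert

namespace Vert

/-- The closed walk around the cactus: it returns to the centre at each of the first `k` multiples
of five. -/
def walk (k j : ℕ) : Vert := if 5 ∣ j ∧ j < 5 * k then w else c j

theorem walk_eq_c {k j : ℕ} (h : ¬ (5 ∣ j ∧ j < 5 * k)) : walk k j = c j := if_neg h

theorem walk_eq_w {k j : ℕ} (h : 5 ∣ j ∧ j < 5 * k) : walk k j = w := if_pos h

/-- The part `o i, …, o (n - 1)` of the outer cycle. -/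
def outer (n i : ℕ) : List Vert := (List.range' i (n - i)).map o

theorem outer_eq_cons {n i : ℕ} (h : i < n) : outer n i = o i :: outer n (i + 1) := by
  unfold outer
  rw [show n - i = n - (i + 1) + 1 by omega, List.range'_succ]
  rfl

theorem outer_self (n : ℕ) : outer n n = [] := by simp [outer]

theorem mem_pathEdges_outer {n i j : ℕ} (hij : i ≤ j) (hj : j + 1 < n) :
    s(o j, o (j + 1)) ∈ pathEdges (outer n i) := by
  induction hij using Nat.decreasingInduction with
  | self =>
    rw [outer_eq_cons (by omega), outer_eq_cons (by omega)]
    exact Or.inl rfl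
  | of_succ m hm ih =>
    rw [outer_eq_cons (by omega), outer_eq_cons (by omega)]
    rw [outer_eq_cons (by omega)] at ih
    exact Or.inr ih

theorem outer_zero_eq {n : ℕ} (hn : 2 ≤ n) :
    outer n 0 = o 0 :: ((List.range' 1 (n - 2)).map o ++ [o (n - 1)]) := by
  rw [outer_eq_cons (by omega), outer]
  congr 1
  rw [show n - (0 + 1) = n - 2 + 1 by omega, List.range'_concat]
  simp
  omega

theorem nodup_outer (n i : ℕ) : (outer n i).Nodup :=
  (List.nodup_range').map fun _ _ h => by simpa using h

/-- The vertices that may be present when the sectors up to index `i` are drawn. -/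
def Allowed (n k i : ℕ) : Vert → Prop
  | w => True
  | o j => j < n
  | r j => j ≤ 2 * i + 2
  | c j => j ≤ i ∧ walk k j = c j

/-- All edges of the sectors up to index `i`, except for additional edges at the centre. -/
structure Contains (k i : ℕ) (E : Set (Sym2 Vert)) : Prop where
  ring : ∀ j < 2 * i + 2, s(r j, r (j + 1)) ∈ E
  outer_spoke : ∀ j ≤ i + 1, s(o j, r (2 * j)) ∈ E
  inner_spoke : ∀ j ≤ i, s(walk k j, r (2 * j + 1)) ∈ E
  inner : ∀ j < i, s(walk k j, walk k (j + 1)) ∈ E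

/-- The sectors up to index `i` are drawn, with `p` pentagons. The part of the upper boundary
between the ring vertices `r 1` and `r (2 * i + 1)` consists of `ws` and `walk k i`. -/
def Drawn (n k i : ℕ) (ws : List Vert) (p : ℕ) : Prop :=
  ∃ (S : Set Vert) (E : Set (Sym2 Vert)),
    Layered (outer n 0) ([o 0, r 0, r 1] ++ (ws ++ walk k i :: r (2 * i + 1) :: r (2 * i + 2) ::
      outer n (i + 1))) S E p ∧
    (∀ v ∈ S, Allowed n k i v) ∧ s(o 0, o (n - 1)) ∉ E ∧ Contains k i E

/-- The three ears are the outer pentagons at `o 0, o 1` and at `o 1, o 2` and the inner pentagon `r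
1, r 2, r 3, c 1, w`. The left end `o 0, r 0, r 1` then stays on the boundary until the construction
closes up. -/
theorem drawn_one {n k : ℕ} (hn : 4 ≤ n) (hk : 1 ≤ k) : Drawn n k 1 [w] 3 := by
  have h0 : Layered (outer n 0) (outer n 0) {v | v ∈ outer n 0} (pathEdges (outer n 0)) 0 := by
    have := nodup_outer n 0
    rw [outer_zero_eq (by omega)] at this ⊢
    exact layered_base this
  have hmem : ∀ v ∈ outer n 0, ∃ j < n, v = o j := by
    intro v hv
    simp only [outer, List.mem_map, List.mem_range'_1] at hv
    obtain ⟨j, hj, rfl⟩ := hv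
    exact ⟨j, by omega, rfl⟩
  have hlast : s(o 0, o (n - 1)) ∉ pathEdges (outer n 0) := by
    intro h
    obtain ⟨P, u, v, Q, hL, he⟩ := exists_split_of_mem_pathEdges h
    -- Neighbours on `outer n i` have consecutive indices, unlike `0` and `n - 1`. The start `i`
    -- varies because the induction strips the prefix `P`.
    have key : ∀ (P : List Vert) (i : ℕ), outer n i = P ++ u :: v :: Q →
        ∃ j, u = o j ∧ v = o (j + 1) := by
      intro P
      induction P with
      | nil =>
        intro i hi
        have h1 : i < n := by
          by_contra hcon
          have : n - i = 0 := by omega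
          simp [outer, this] at hi
        rw [outer_eq_cons h1] at hi
        have h2 : i + 1 < n := by
          by_contra hcon
          have : n - (i + 1) = 0 := by omega
          simp [outer, this] at hi
        rw [outer_eq_cons h2] at hi
        simp only [List.nil_append, List.cons.injEq] at hi
        exact ⟨i, hi.1.symm, hi.2.1.symm⟩
      | cons a P ih =>
        intro i hi
        have h1 : i < n := by
          by_contra hcon
          have : n - i = 0 := by omega
          simp [outer, this] at hi
        rw [outer_eq_cons h1] at hi
        simp only [List.cons_append, List.cons.injEq] at hi
        exact ih _ hi.2
    obtain ⟨j, rfl, rfl⟩ := key P 0 hL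
    simp only [Sym2.eq_iff, o.injEq] at he
    omega
  obtain ⟨S, hS⟩ : ∃ S, S = {v | v ∈ outer n 0} := ⟨_, rfl⟩
  obtain ⟨E, hE⟩ : ∃ E, E = pathEdges (outer n 0) := ⟨_, rfl⟩
  have hmem' : ∀ v ∈ S, ∃ j < n, v = o j := by rw [hS]; exact hmem
  have htop : outer n 0 = o 0 :: o 1 :: o 2 :: outer n 3 := by
    rw [outer_eq_cons (by omega), outer_eq_cons (by omega), outer_eq_cons (by omega)]
  rw [← hS, ← hE] at h0
  rw [← hE] at hlast
  generalize hB : outer n 0 = B at h0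
  rw [hB] at htop
  have h0' : Layered B (o 0 :: o 1 :: o 2 :: outer n 3) S E 0 := htop ▸ h0
  have h1 := Layered.ear_cons [] (l := o 0) [] (r := o 1) (r 0) [r 1, r 2] h0' (by simp)
    (by
      intro v hv hvS
      obtain ⟨j, -, rfl⟩ := hmem' v hvS
      simp at hv) rfl
  have h2 := Layered.ear_cons [o 0, r 0, r 1] (l := r 2) [o 1] (r := o 2) (r 3) [r 4] h1 (by simp)
    (by
      rintro v hv (hvS | hvS)
      · obtain ⟨j, -, rfl⟩ := hmem' v hvS
        simp at hv
      · simp at hv hvS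
        rcases hv with rfl | rfl <;> simp at hvS) rfl
  have h3 := Layered.ear_cons [o 0, r 0] (l := r 1) [r 2] (r := r 3) w [c 1] h2 (by simp)
    (by
      rintro v hv ((hvS | hvS) | hvS)
      · obtain ⟨j, -, rfl⟩ := hmem' v hvS
        simp at hv
      · simp at hv hvS
        rcases hv with rfl | rfl <;> simp at hvS
      · simp at hv hvS
        rcases hv with rfl | rfl <;> simp at hvS) rfl
  have w0 : walk k 0 = w := walk_eq_w (by omega)
  have w1 : walk k 1 = c 1 := walk_eq_c (by omega)
  refine ⟨_, _, by
    rw [w1, hB, outer_eq_cons (show 1 + 1 < n by omega)]; exact h3, ?_, ?_, ?_, ?_, ?_, ?_⟩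
  · rintro v (((hv | hv) | hv) | hv)
    · obtain ⟨j, hj, rfl⟩ := hmem' v hv
      exact hj
    · simp at hv
      rcases hv with rfl | rfl | rfl <;> simp [Allowed]
    · simp at hv
      rcases hv with rfl | rfl <;> simp [Allowed]
    · simp at hv
      rcases hv with rfl | rfl <;> simp [Allowed, w1]
  · rintro (((h | h) | h) | h)
    · exact hlast h
    all_goals simp at h
  · intro j hj
    have : j = 0 ∨ j = 1 ∨ j = 2 ∨ j = 3 := by omega
    rcases this with rfl | rfl | rfl | rfl <;> simp
  · intro j hj
    have : j = 0 ∨ j = 1 ∨ j = 2 := by omega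
    rcases this with rfl | rfl | rfl <;> simp
  · intro j hj
    have : j = 0 ∨ j = 1 := by omega
    rcases this with rfl | rfl <;> simp [w0, w1]
  · intro j hj
    have : j = 0 := by omega
    subst this
    simp [w0, w1]

end Vert

end Construction

/-! ### Growing the drawing sector by sector -/

section Construction

open Set

namespace Vert

variable {n k i p : ℕ} {ws : List Vert} {S : Set Vert} {E E' : Set (Sym2 Vert)} {x : Vert}

theorem Allowed.mono {v : Vert} {j : ℕ} (h : Allowed n k i v) (hij : i ≤ j) : Allowed n k j v := by
  cases v with
  | w => trivial
  | o m => exact h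
  | r m => exact le_trans h (by omega)
  | c m => exact ⟨h.1.trans hij, h.2⟩

/-- The pentagon is `o (i+1), o (i+2), r (2i+4), r (2i+3), r (2i+2)`; the ear covers `o (i+1)`. -/
theorem layered_outer_pentagon
    (h : Layered (outer n 0) ([o 0, r 0, r 1] ++ (ws ++ x :: r (2 * i + 1) :: r (2 * i + 2) ::
      outer n (i + 1))) S E p) (hS : ∀ v ∈ S, Allowed n k i v) (hi : i + 2 < n) :
    Layered (outer n 0) ([o 0, r 0, r 1] ++ (ws ++ x :: r (2 * i + 1) :: r (2 * i + 2) ::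
      r (2 * i + 3) :: r (2 * i + 4) :: outer n (i + 2)))
      (S ∪ {r (2 * i + 3), r (2 * i + 4)})
      (E ∪ {s(r (2 * i + 2), r (2 * i + 3)), s(r (2 * i + 3), r (2 * i + 4)),
        s(r (2 * i + 4), o (i + 2))}) (p + 1) := by
  rw [outer_eq_cons (show i + 1 < n by omega), outer_eq_cons (show i + 1 + 1 < n by omega)] at h
  have := Layered.ear_cons ([o 0, r 0, r 1] ++ (ws ++ [x, r (2 * i + 1)])) (l := r (2 * i + 2))
    [o (i + 1)] (r := o (i + 2)) (Q := outer n (i + 3)) (r (2 * i + 3)) [r (2 * i + 4)]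
    (by simpa using h) (by simp) (by
      intro v hv hvS
      have := hS v hvS
      simp only [List.mem_cons, List.not_mem_nil, or_false] at hv
      rcases hv with rfl | rfl <;> simp only [Allowed] at this <;> omega) rfl
  rw [outer_eq_cons hi]
  convert this using 1
  · simp
  · ext v; simp [or_comm, or_left_comm]
  · ext e; simp

/-- Here `x` and `y` are consecutive on the walk, and the pentagon is `x, r (2i+1), r (2i+2), r
(2i+3), y`. -/
theorem layered_inner_pentagon {y : Vert} {t : List Vert}
    (h : Layered (outer n 0) ([o 0, r 0, r 1] ++ (ws ++ x :: r (2 * i + 1) :: r (2 * i + 2) ::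
      r (2 * i + 3) :: t)) S E p) (hy : y ∉ S) :
    Layered (outer n 0) ([o 0, r 0, r 1] ++ (ws ++ x :: y :: r (2 * i + 3) :: t))
      (S ∪ {y}) (E ∪ {s(x, y), s(y, r (2 * i + 3))}) (p + 1) := by
  have := Layered.ear_cons ([o 0, r 0, r 1] ++ ws) (l := x)
    [r (2 * i + 1), r (2 * i + 2)] (r := r (2 * i + 3)) (Q := t) y []
    (by simpa using h) (by simp) (by simpa using hy) rfl
  convert this using 1
  · simp
  · ext v; simp [or_comm]
  · ext e; simp

theorem Contains.succ (h : Contains k i E) (hE : E ⊆ E')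
    (h1 : s(r (2 * i + 2), r (2 * i + 3)) ∈ E') (h2 : s(r (2 * i + 3), r (2 * i + 4)) ∈ E')
    (h3 : s(r (2 * i + 4), o (i + 2)) ∈ E') (h4 : s(walk k i, walk k (i + 1)) ∈ E')
    (h5 : s(walk k (i + 1), r (2 * i + 3)) ∈ E') : Contains k (i + 1) E' := by
  refine ⟨fun j hj => ?_, fun j hj => ?_, fun j hj => ?_, fun j hj => ?_⟩
  · obtain hj | rfl | rfl : j < 2 * i + 2 ∨ j = 2 * i + 2 ∨ j = 2 * i + 3 := by omega
    · exact hE (h.ring j hj)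
    · exact h1
    · exact h2
  · obtain hj | rfl : j ≤ i + 1 ∨ j = i + 2 := by omega
    · exact hE (h.outer_spoke j hj)
    · rw [Sym2.eq_swap]; exact h3
  · obtain hj | rfl : j ≤ i ∨ j = i + 1 := by omega
    · exact hE (h.inner_spoke j hj)
    · exact h5
  · obtain hj | rfl : j < i ∨ j = i := by omega
    · exact hE (h.inner j hj)
    · exact h4

theorem Drawn.advance (h : Drawn n k i ws p) (hi : i + 2 < n) (hw : walk k (i + 1) = c (i + 1)) :
    Drawn n k (i + 1) (ws ++ [walk k i]) (p + 2) := by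
  obtain ⟨S, E, hL, hS, hlast, hC⟩ := h
  have hA := layered_outer_pentagon hL hS hi
  have hB := layered_inner_pentagon (y := c (i + 1)) hA (by
    rintro (h | h)
    · have := (hS _ h).1
      omega
    · simp at h)
  refine ⟨_, _, by rw [hw]; exact hB.of_top_eq (by simp [mul_add]), ?_, ?_, ?_⟩
  · rintro v ((hv | rfl | rfl) | rfl)
    · exact (hS v hv).mono (by omega)
    · simp only [Allowed]; omega
    · simp only [Allowed]; omega
    · exact ⟨le_rfl, hw⟩
  · rintro ((h | h) | h)
    · exact hlast h
    all_goals simp at h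
  · refine hC.succ (fun e he => Or.inl (Or.inl he)) ?_ ?_ ?_ ?_ ?_ <;> simp [hw]

/-- After the ordinary step, `w, y, z, walk k i, c (i+1)` are consecutive on the boundary, so the
edge from `w` to `c (i+1)` cuts off a pentagon of the cactus. It is either the last edge of a petal
or a chord of the long cycle. By `hi0` it differs from the edge from `walk k i` to `c (i+1)`. -/
theorem Drawn.advance_chord {y z : Vert} (h : Drawn n k i [w, y, z] p) (hi : i + 2 < n)
    (hw : walk k (i + 1) = c (i + 1)) (hi0 : walk k i ≠ w) : Drawn n k (i + 1) [w] (p + 3) := by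
  obtain ⟨S, E, hL, hS, hlast, hC⟩ := h
  have hA := layered_outer_pentagon hL hS hi
  have hc : c (i + 1) ∉ S := fun h => by
    have := (hS _ h).1
    omega
  have hB := layered_inner_pentagon (y := c (i + 1)) hA (by
    rintro (h | h)
    · exact hc h
    · simp at h)
  have hD := Layered.chord [o 0, r 0, r 1] (l := w) [y, z, walk k i] (r := c (i + 1))
    hB (by
      rintro ((h | h) | h)
      · exact hc (hL.ends_mem _ h _ (Sym2.mem_mk_right _ _))
      · simp at h
      · simp [hi0.symm] at h) rfl
  refine ⟨_, _, by rw [hw]; exact hD, ?_, ?_, ?_⟩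
  · rintro v ((hv | rfl | rfl) | rfl)
    · exact (hS v hv).mono (by omega)
    · simp only [Allowed]; omega
    · simp only [Allowed]; omega
    · exact ⟨le_rfl, hw⟩
  · rintro (((h | h) | h) | h)
    · exact hlast h
    all_goals simp at h
  · refine hC.succ (fun e he => Or.inl (Or.inl (Or.inl he))) ?_ ?_ ?_ ?_ ?_ <;> simp [hw]

/-- The walk returns to `w`, which is drawn already and is the left neighbour of `walk k i` on the
boundary. The inner pentagon thus needs only the spoke from `w` to `r (2i+3)`. -/
theorem Drawn.close_petal (h : Drawn n k i [w] p) (hi : i + 2 < n) (hw : walk k (i + 1) = w) :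
    Drawn n k (i + 1) [] (p + 2) := by
  obtain ⟨S, E, hL, hS, hlast, hC⟩ := h
  have hA := layered_outer_pentagon hL hS hi
  have hr : r (2 * i + 3) ∉ S := fun h => by
    have := hS _ h
    simp only [Allowed] at this
    omega
  have hB := Layered.chord [o 0, r 0, r 1] (l := w) [walk k i, r (2 * i + 1), r (2 * i + 2)]
    (r := r (2 * i + 3)) hA (by
      rintro (h | h)
      · exact hr (hL.ends_mem _ h _ (Sym2.mem_mk_right _ _))
      · simp at h) rfl
  have hwi : s(walk k i, w) ∈ E := by
    rw [Sym2.eq_swap]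
    exact hL.top_edges (by simp)
  refine ⟨_, _, by rw [hw]; exact hB, ?_, ?_, ?_⟩
  · rintro v (hv | rfl | rfl)
    · exact (hS v hv).mono (by omega)
    · simp only [Allowed]; omega
    · simp only [Allowed]; omega
  · rintro ((h | h) | h)
    · exact hlast h
    all_goals simp at h
  · refine hC.succ (fun e he => Or.inl (Or.inl he)) ?_ ?_ ?_ ?_ ?_
    · simp
    · simp
    · simp
    · rw [hw]; exact Or.inl (Or.inl hwi)
    · simp [hw]

/-- The closing four pentagons. -/
theorem Drawn.close {y z : Vert} {m : ℕ} (h : Drawn (m + 2) k m [w, y, z] p)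
    (hw : walk k (m + 1) = c (m + 1)) (h0 : walk k 0 = w) :
    ∃ (S : Set Vert) (E : Set (Sym2 Vert)),
      Layered (outer (m + 2) 0) [o 0, o (m + 1)] S E (p + 4) ∧
      (∀ v ∈ S, v ≠ r (2 * m + 4) ∧ (v = r (2 * m + 3) ∨ Allowed (m + 2) k (m + 1) v)) ∧
      Contains k m E ∧ s(r (2 * m + 2), r (2 * m + 3)) ∈ E ∧ s(r (2 * m + 3), r 0) ∈ E ∧
      s(o 0, o (m + 1)) ∈ E ∧ s(walk k m, walk k (m + 1)) ∈ E ∧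
      s(walk k (m + 1), r (2 * m + 3)) ∈ E ∧ s(walk k (m + 1), walk k 0) ∈ E := by
  obtain ⟨S, E, hL, hS, hlast, hC⟩ := h
  have hc : c (m + 1) ∉ S := fun h => by
    have := (hS _ h).1
    omega
  have hr : r (2 * m + 3) ∉ S := fun h => by
    have := hS _ h
    simp only [Allowed] at this
    omega
  rw [outer_eq_cons (show m + 1 < m + 2 by omega), outer_self] at hL
  -- The four ears give the last pentagon of the cactus, the inner pentagons on either side of `r
  -- (2m+3)`, the second of which closes the ring, and the outer pentagon whose edge from `o 0` to
  -- `o (m+1)` completes the `n`-cycle.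
  have h1 := Layered.ear_cons [o 0, r 0, r 1] (l := w) [y, z] (r := walk k m) (c (m + 1)) []
    hL (by simp) (by simpa using hc) rfl
  have h2 := Layered.ear_cons [o 0, r 0, r 1, w] (l := c (m + 1)) [walk k m, r (2 * m + 1)]
    (r := r (2 * m + 2)) (r (2 * m + 3)) [] h1 (by simp) (by simpa using hr) rfl
  have h3 := Layered.chord [o 0] (l := r 0) [r 1, w, c (m + 1)] (r := r (2 * m + 3))
    h2 (by
      rintro ((h | h) | h)
      · exact hr (hL.ends_mem _ h _ (Sym2.mem_mk_right _ _))
      · simp at h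
      · simp at h) rfl
  have h4 := Layered.chord [] (l := o 0) [r 0, r (2 * m + 3), r (2 * m + 2)] (r := o (m + 1))
    h3 (by
      rintro (((h | h) | h) | h)
      · exact hlast h
      · simp at h
      · simp at h
      · simp at h) rfl
  refine ⟨_, _, h4, ?_, ?_, ?_⟩
  · rintro v ((hv | hv) | hv)
    · refine ⟨?_, Or.inr ((hS v hv).mono (by omega))⟩
      rintro rfl
      have := hS _ hv
      simp only [Allowed] at this
      omega
    · simp at hv
      subst hv
      exact ⟨by simp, Or.inr ⟨le_rfl, hw⟩⟩
    · simp at hv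
      subst hv
      exact ⟨by simp, Or.inl rfl⟩
  · have hsub : ∀ e ∈ E, e ∈ E ∪ pathEdges (w :: ([c (m + 1)] ++ [walk k m])) ∪
        pathEdges (c (m + 1) :: ([r (2 * m + 3)] ++ [r (2 * m + 2)])) ∪
        {s(r 0, r (2 * m + 3))} ∪ {s(o 0, o (m + 1))} :=
      fun e he => Or.inl (Or.inl (Or.inl (Or.inl he)))
    exact ⟨fun j hj => hsub _ (hC.ring j hj), fun j hj => hsub _ (hC.outer_spoke j hj),
      fun j hj => hsub _ (hC.inner_spoke j hj), fun j hj => hsub _ (hC.inner j hj)⟩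
  · rw [hw, h0]
    simp

/-- The five steps complete the current petal, return to `w`, and draw three vertices of the next
one. They yield ten pentagons along the ring and one petal. -/
theorem Drawn.petal {y z : Vert} (h : Drawn n k i [w, y, z] p) (hi : i + 6 < n)
    (h5 : 5 ∣ i + 2) (hk : i + 2 < 5 * k) :
    ∃ y z, Drawn n k (i + 5) [w, y, z] (p + 11) := by
  have h1 := h.advance_chord (by omega) (walk_eq_c (by omega))
    (by rw [walk_eq_c (by omega)]; simp)
  have h2 := h1.close_petal (by omega) (walk_eq_w (by omega))
  have h3 := h2.advance (by omega) (walk_eq_c (by omega))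
  have h4 := h3.advance (by omega) (walk_eq_c (by omega))
  have h5' := h4.advance (by omega) (walk_eq_c (by omega))
  rw [walk_eq_w (j := i + 1 + 1) (by omega)] at h5'
  exact ⟨_, _, h5'⟩

/-- From here on the walk stays on the long cycle. Three steps yield six pentagons along the ring,
and the chord from `w` yields one more. -/
theorem Drawn.fan {y z : Vert} (h : Drawn n k i [w, y, z] p) (hi : i + 4 < n)
    (hk : 5 * k ≤ i + 2) : ∃ y z, Drawn n k (i + 3) [w, y, z] (p + 7) := by
  have h1 := h.advance_chord (by omega) (walk_eq_c (by omega))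
    (by rw [walk_eq_c (by omega)]; simp)
  have h2 := h1.advance (by omega) (walk_eq_c (by omega))
  have h3 := h2.advance (by omega) (walk_eq_c (by omega))
  exact ⟨_, _, h3⟩

/-- At index `5q + 3` the current petal lacks just one vertex, which is the state in which both
`Drawn.petal` and `Drawn.fan` start and end. -/
theorem exists_drawn_petals {k q : ℕ} (hn : 5 * k ≤ n) (hk : q + 1 ≤ k) :
    ∃ y z, Drawn n k (5 * q + 3) [w, y, z] (11 * q + 7) := by
  induction q with
  | zero =>
    have h1 := drawn_one (n := n) (k := k) (by omega) (by omega)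
    have h2 := h1.advance (by omega) (walk_eq_c (by omega))
    have h3 := h2.advance (by omega) (walk_eq_c (by omega))
    exact ⟨_, _, h3⟩
  | succ q ih =>
    obtain ⟨y, z, h⟩ := ih (by omega)
    exact h.petal (by omega) (by omega) (by omega)

theorem exists_drawn_fan {k l : ℕ} (hk : 1 ≤ k) (m : ℕ) (hm : m ≤ l) :
    ∃ y z, Drawn (5 * k + 3 * l) k (5 * k - 2 + 3 * m) [w, y, z] (11 * (k - 1) + 7 + 7 * m) := by
  induction m with
  | zero =>
    obtain ⟨y, z, h⟩ := exists_drawn_petals (n := 5 * k + 3 * l) (k := k) (q := k - 1)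
      (by omega) (by omega)
    rw [show 5 * (k - 1) + 3 = 5 * k - 2 + 3 * 0 by omega] at h
    exact ⟨y, z, h⟩
  | succ m ih =>
    obtain ⟨y, z, h⟩ := ih (by omega)
    exact h.fan (by omega) (by omega)

end Vert

end Construction

/-! ### Assembling the pentagulation -/

section Construction

open Set

theorem IsKConnected.connected {V : Type} [Finite V] {G : SimpleGraph V} {k : ℕ}
    (h : IsKConnected G k) (hk : 0 < k) : G.Connected := by
  have := h.2 ∅ (by simpa using hk)
  rw [compl_empty] at this
  exact (SimpleGraph.induceUnivIso G).connected_iff.1 this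

/-- A cyclic shift either does not wrap around or wraps around once; in this form index conditions
become linear arithmetic. -/
theorem add_mod_cases {N a : ℕ} (i : ℕ) (ha : a ≤ N) (hN : 0 < N) :
    (i + a) % N < N ∧ i % N < N ∧
      ((i + a) % N = i % N + a ∨ (i + a) % N + N = i % N + a) := by
  have h1 := Nat.mod_lt i hN
  refine ⟨Nat.mod_lt _ hN, h1, ?_⟩
  have h2 : (i + a) % N = (i % N + a) % N := by simp
  rcases lt_or_ge (i % N + a) N with h | h
  · exact Or.inl (h2.trans (Nat.mod_eq_of_lt h))
  · right
    rw [h2, Nat.mod_eq_sub_mod h, Nat.mod_eq_of_lt (by omega)]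
    omega

namespace Vert

theorem mem_pentagonCounts {k l : ℕ} (hk : 1 ≤ k) : 11 * k + 7 * l ∈ pentagonCounts (5 * k + 3 * l) := by
  obtain ⟨y, z, hD⟩ := exists_drawn_fan hk l le_rfl
  obtain ⟨m, hm⟩ : ∃ m, 5 * k + 3 * l = m + 2 := ⟨5 * k + 3 * l - 2, by omega⟩
  rw [show 5 * k - 2 + 3 * l = m by omega, hm] at hD
  obtain ⟨S, E, hL, hS, hC, hr1, hr2, ho, hw1, hw2, hw3⟩ :=
    hD.close (walk_eq_c (by omega)) (walk_eq_w (by omega))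
  rw [show 11 * (k - 1) + 7 + 7 * l + 4 = 11 * k + 7 * l by omega] at hL
  rw [hm]
  have hfin : Finite S := hL.finite.to_subtype
  have hring : ∀ j, j < 2 * m + 3 → s(r j, r (j + 1)) ∈ E := by
    intro j hj
    obtain hj | rfl : j < 2 * m + 2 ∨ j = 2 * m + 2 := by omega
    · exact hC.ring j hj
    · exact hr1
  have hinner : ∀ j < m + 1, s(walk k j, walk k (j + 1)) ∈ E := by
    intro j hj
    obtain hj | rfl : j < m ∨ j = m := by omega
    · exact hC.inner j hj
    · exact hw1
  have hspoke : ∀ j ≤ m + 1, s(walk k j, r (2 * j + 1)) ∈ E := by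
    intro j hj
    obtain hj | rfl : j ≤ m ∨ j = m + 1 := by omega
    · exact hC.inner_spoke j hj
    · exact hw2
  have houter : ∀ j, j + 1 < m + 2 → s(o j, o (j + 1)) ∈ E := fun j hj =>
    hL.bottom_edges (mem_pathEdges_outer (Nat.zero_le j) hj)
  have hoS : ∀ j < m + 2, o j ∈ S := fun j hj =>
    hL.ends_mem _ (hC.outer_spoke j (by omega)) _ (Sym2.mem_mk_left _ _)
  have hwS : ∀ j < m + 2, walk k j ∈ S := fun j hj =>
    hL.ends_mem _ (hspoke j (by omega)) _ (Sym2.mem_mk_left _ _)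
  have hrS : ∀ j < 2 * (m + 2), r j ∈ S := by
    intro j hj
    obtain hj | rfl : j < 2 * m + 3 ∨ j = 2 * m + 3 := by omega
    · exact hL.ends_mem _ (hring j hj) _ (Sym2.mem_mk_left _ _)
    · exact hL.ends_mem _ hr1 _ (Sym2.mem_mk_right _ _)
  have hadj : ∀ u v : S, s(u.1, v.1) ∈ E → (graphWith S E).Adj u v := fun u v h =>
    graphWith_adj.2 ⟨h, hL.ne_of_mem h⟩
  let ri : ℕ → S := fun i => ⟨r (i % (2 * (m + 2))), hrS _ (Nat.mod_lt _ (by omega))⟩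
  let ou : ℕ → S := fun i => ⟨o (i % (m + 2)), hoS _ (Nat.mod_lt _ (by omega))⟩
  let wa : ℕ → S := fun i => ⟨walk k (i % (m + 2)), hwS _ (Nat.mod_lt _ (by omega))⟩
  have hRing : IsRing (graphWith S E) (m + 2) ri := by
    refine ⟨fun i => hadj _ _ ?_, fun i j => ?_⟩
    · obtain ⟨h1, h2, h3 | h3⟩ := add_mod_cases (N := 2 * (m + 2)) (a := 1) i (by omega) (by omega)
      · simp only [ri, h3]
        exact hring _ (by omega)
      · simp only [ri]
        rw [show (i + 1) % (2 * (m + 2)) = 0 by omega,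
          show i % (2 * (m + 2)) = 2 * m + 3 by omega]
        exact hr2
    · simp [ri, Nat.ModEq]
  have hOuter : IsSide (graphWith S E) (m + 2) ri ou 0 := by
    refine ⟨fun i => hadj _ _ ?_, fun i => hadj _ _ ?_, fun i => ?_, fun i => ?_, fun i j => ?_⟩
    · obtain ⟨h1, h2, h3 | h3⟩ := add_mod_cases (N := m + 2) (a := 1) i (by omega) (by omega)
      · simp only [ou, h3]
        exact houter _ (by omega)
      · simp only [ou]
        rw [show (i + 1) % (m + 2) = 0 by omega, show i % (m + 2) = m + 1 by omega, Sym2.eq_swap]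
        exact ho
    · simp only [ou, ri, add_zero, Nat.mul_mod_mul_left]
      have := Nat.mod_lt i (show 0 < m + 2 by omega)
      exact hC.outer_spoke _ (by omega)
    · simp [ou]
    · have := add_mod_cases (N := m + 2) (a := 2) i (by omega) (by omega)
      simp only [ou, ne_eq, Subtype.mk.injEq, o.injEq]
      omega
    · simp [ou, ri]
  have hWalk : IsSide (graphWith S E) (m + 2) ri wa 1 := by
    refine ⟨fun i => hadj _ _ ?_, fun i => hadj _ _ ?_, fun i => ?_, fun i => ?_, fun i j => ?_⟩
    · obtain ⟨h1, h2, h3 | h3⟩ := add_mod_cases (N := m + 2) (a := 1) i (by omega) (by omega)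
      · simp only [wa, h3]
        exact hinner _ (by omega)
      · simp only [wa]
        rw [show (i + 1) % (m + 2) = 0 by omega, show i % (m + 2) = m + 1 by omega]
        exact hw3
    · have h1 := add_mod_cases (N := 2 * (m + 2)) (a := 1) (2 * i) (by omega) (by omega)
      have h2 : 2 * i % (2 * (m + 2)) = 2 * (i % (m + 2)) := Nat.mul_mod_mul_left _ _ _
      have h3 := Nat.mod_lt i (show 0 < m + 2 by omega)
      simp only [wa, ri]
      rw [show (2 * i + 1) % (2 * (m + 2)) = 2 * (i % (m + 2)) + 1 by omega]
      exact hspoke _ (by omega)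
    · simp [wa]
    -- The walk meets `w` only at multiples of five below `5k`, and no two of these are two steps
    -- apart, even across the wrap from `n - 1` to `0`.
    · have := add_mod_cases (N := m + 2) (a := 2) i (by omega) (by omega)
      simp only [wa, ne_eq, Subtype.mk.injEq, walk]
      split_ifs
      · omega
      · simp
      · simp
      · simp only [c.injEq]
        omega
    · simp only [wa, ri, ne_eq, Subtype.mk.injEq, walk]
      split_ifs <;> simp
  have hmod : ∀ {j N : ℕ}, j < N → j % N = j := Nat.mod_eq_of_lt
  have hconn : IsKConnected (graphWith S E) 3 := by
    refine isKConnected_three (by omega) hRing hOuter hWalk ?_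
    rintro ⟨v, hv⟩
    have hv' := hS v hv
    cases v with
    | w => exact Or.inr (Or.inr ⟨0, Subtype.ext (walk_eq_w (by simp; omega)).symm⟩)
    | o j =>
      simp only [Allowed, reduceCtorEq, false_or] at hv'
      exact Or.inr (Or.inl ⟨j, Subtype.ext (congrArg o (hmod hv'.2).symm)⟩)
    | r j =>
      simp only [Allowed, ne_eq, r.injEq] at hv'
      -- `Allowed` alone admits `r (2m+4)`, one index too many for a ring of length `2m + 4`; the
      -- first part of `hS` excludes it.
      exact Or.inl ⟨j, Subtype.ext (congrArg r (hmod (by omega)).symm)⟩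
    | c j =>
      simp only [Allowed, reduceCtorEq, false_or] at hv'
      refine Or.inr (Or.inr ⟨j, Subtype.ext ?_⟩)
      simp only [wa]
      rw [hmod (by omega), hv'.2.2]
  have hB := outer_zero_eq (n := m + 2) (by omega)
  have hnd := nodup_outer (m + 2) 0
  rw [hB] at hL hnd
  obtain ⟨D, hD⟩ := hL.exists_isPentagulation hnd (by simp; omega)
    (hconn.connected (by norm_num))
  refine ⟨S, hfin, graphWith S E, hconn, D, ?_⟩
  simpa using hD

end Vert

end Construction

theorem theorem2 (n : ℕ) (hn : 13 ≤ n) (k l : ℤ) (hkl : (n : ℤ) = 5 * k + 3 * l)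
    (hl0 : 0 ≤ l) (hl4 : l ≤ 4) :
    (pentagonCounts n).Nonempty ∧ (Pg n : ℤ) ≤ 2 * (n : ℤ) + k + l := by
  obtain ⟨l, rfl⟩ := Int.eq_ofNat_of_zero_le hl0
  -- From `n ≥ 13` and `3l ≤ 12` follows `5k ≥ 1`, so there is at least one petal.
  obtain ⟨k, rfl⟩ := Int.eq_ofNat_of_zero_le (show 0 ≤ k by omega)
  obtain rfl : n = 5 * k + 3 * l := by omega
  have h := Vert.mem_pentagonCounts (k := k) (l := l) (by omega)
  refine ⟨⟨_, h⟩, ?_⟩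
  -- This is the claimed bound, as `2(5k + 3l) + k + l = 11k + 7l`.
  have : Pg (5 * k + 3 * l) ≤ 11 * k + 7 * l := Nat.sInf_le h
  push_cast
  omega
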